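/- Let $d\in\mathbb{N}$, $d\ge 1$, let $\Omega\subseteq\mathbb{R}^d$ be Lebesgue measurable, and let $H$ be a selfadjoint operator in the complex Hilbert space $L_2(\Omega)$ whose spectrum $\sigma(H)$ is non-empty and bounded below; put $$E_0:=\inf\sigma(H)\in\mathbb{R}.$$ Let $(e^{-tH})_{t\ge0}$ be the $C_0$-semigroup on $L_2(\Omega)$ generated by $-H$. Suppose that it satisfies Gaussian upper bounds: there are constants $M\ge1$, $\omega\in\mathbb{R}$ and $a>0$ such that for every $t>0$ the operator $e^{-tH}$ has an integral kernel $p_t$, i.e. $(e^{-tH}f)(x)=\int_\Omega p_t(x,y)f(y)\,dy$ for all $f\in L_2(\Omega)$ and a.e. $x\in\Omega$, with $$|p_t(x,y)|\le Me^{\omega t}(a\pi t)^{-d/2}\exp\Bigl(-\frac{|x-y|^2}{at}\Bigr)\qquad\text{for a.e. }(x,y)\in\Omega\times\Omega.$$ For a bounded operator $B$ on $L_2(\Omega)$ let $$\|B\|_{\infty\to\infty}:=\sup\bigl\{\|Bf\|_\infty : f\in L_2(\Omega)\cap L_\infty(\Omega),\ \|f\|_\infty\le1\bigr\}\in[0,\infty].$$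 Then for all $\varepsilon\in(0,1]$ and all $t\ge0$, $$\|e^{-tH}\|_{\infty\to\infty}\le 2^{1/4}M\left(\frac{1+1/\sqrt\varepsilon}{2}\right)^{d/2}e^{\varepsilon(E_0+\omega)t-E_0t}.$$ -/

import Mathlib

open MeasureTheory Filter Topology
open scoped ENNReal

noncomputable section

/-- The complex Hilbert space `L₂(Ω)`, for `Ω ⊆ ℝ^d` with Lebesgue measure. -/
abbrev L2 {d : ℕ} (Ω : Set (EuclideanSpace ℝ (Fin d))) : Type :=
  Lp ℂ 2 (volume.restrict Ω)

section Abstract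

variable {X : Type*} [NormedAddCommGroup X] [NormedSpace ℂ X]

/-- The resolvent set of a (not necessarily bounded or everywhere defined) operator `A`: those
`z` for which `z - A : D(A) → X` is bijective with bounded inverse `R`. -/
def opResolventSet (A : X →ₗ.[ℂ] X) : Set ℂ :=
  {z | ∃ R : X →L[ℂ] X,
      (∀ f : X, ∃ h : R f ∈ A.domain, z • R f - A ⟨R f, h⟩ = f) ∧
      (∀ u : A.domain, R (z • (u : X) - A u) = u)}

/-- The spectrum of a (not necessarily bounded or everywhere defined) operator `A`. -/
def opSpectrum (A : X →ₗ.[ℂ] X) : Set ℂ := (opResolventSet A)ᶜ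

/-- `(T t)_{t ≥ 0}` is a `C₀`-semigroup (the values `T t` for `t < 0` play no role). -/
structure IsC0Semigroup (T : ℝ → X →L[ℂ] X) : Prop where
  zero : T 0 = ContinuousLinearMap.id ℂ X
  add : ∀ s t : ℝ, 0 ≤ s → 0 ≤ t → T (s + t) = (T s).comp (T t)
  strongly_continuous : ∀ f : X, Tendsto (fun t : ℝ => T t f) (𝓝[>] 0) (𝓝 f)

/-- `A` is the generator of the semigroup `T`: `f ∈ D(A)` and `A f = g` if and only if
`(T h f - f) / h → g` as `h → 0+`. -/
def IsGenerator (T : ℝ → X →L[ℂ] X) (A : X →ₗ.[ℂ] X) : Prop :=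
  ∀ f g : X, (f, g) ∈ A.graph ↔
    Tendsto (fun h : ℝ => ((h⁻¹ : ℝ) : ℂ) • (T h f - f)) (𝓝[>] 0) (𝓝 g)

end Abstract

section Concrete

variable {d : ℕ} {Ω : Set (EuclideanSpace ℝ (Fin d))}

/-- The bounded operator `B` on `L₂(Ω)` has the integral kernel `p`:
`(B f)(x) = ∫_Ω p(x,y) f(y) dy` for a.e. `x ∈ Ω`, for every `f ∈ L₂(Ω)`. -/
def HasIntegralKernel (B : L2 Ω →L[ℂ] L2 Ω)
    (p : EuclideanSpace ℝ (Fin d) × EuclideanSpace ℝ (Fin d) → ℂ) : Prop :=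
  AEStronglyMeasurable p ((volume.restrict Ω).prod (volume.restrict Ω)) ∧
  ∀ f : L2 Ω, ∀ᵐ x ∂(volume.restrict Ω),
    Integrable (fun y => p (x, y) * f y) (volume.restrict Ω) ∧
    B f x = ∫ y in Ω, p (x, y) * f y

/-- Gaussian upper bounds with constants `M, ω, a`: for every `t > 0` the operator `T t` has an
integral kernel `p_t`, and
`|p_t(x,y)| ≤ M e^{ω t} (a π t)^{-d/2} exp(-|x-y|² / (a t))` for a.e. `(x,y) ∈ Ω × Ω`. -/
def HasGaussianUpperBounds (T : ℝ → L2 Ω →L[ℂ] L2 Ω) (M ω a : ℝ) : Prop :=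
  ∀ t : ℝ, 0 < t →
    ∃ p : EuclideanSpace ℝ (Fin d) × EuclideanSpace ℝ (Fin d) → ℂ,
      HasIntegralKernel (T t) p ∧
      ∀ᵐ z ∂((volume.restrict Ω).prod (volume.restrict Ω)),
        ‖p z‖ ≤ M * Real.exp (ω * t) * (a * Real.pi * t) ^ (-(d : ℝ) / 2)
          * Real.exp (-(‖z.1 - z.2‖ ^ 2 / (a * t)))

/-- The norm `‖B‖_{∞→∞} = sup { ‖B f‖_∞ : f ∈ L₂(Ω) ∩ L_∞(Ω), ‖f‖_∞ ≤ 1 } ∈ [0,∞]` of a bounded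
operator `B` on `L₂(Ω)`. -/
def normInftyInfty (B : L2 Ω →L[ℂ] L2 Ω) : ℝ≥0∞ :=
  ⨆ (f : L2 Ω) (_ : eLpNorm f ∞ (volume.restrict Ω) ≤ 1),
    eLpNorm (B f) ∞ (volume.restrict Ω)

end Concrete

end

/-! Write `T t = T r ∘ T s` with `r = ε t`, `s = (1 - ε) t`. The factor `T r` is estimated by its
kernel and costs `e^{ω r}`; the factor `T s` is estimated in weighted `L₂` and gains `e^{-E₀ s}`.

The core is the weighted estimate `norm_gaussianOp_apply_le`: Gaussian weights centred at any point
can be used without spoiling the sharp spectral factor `e^{-E s}`. Since `T` is a semigroup of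
positive operators with `‖T 1‖ ≤ e^{-E}`, it has the form `T s = e^{-E s} A^s` with `0 ≤ A ≤ 1`, and
`A^z` is a holomorphic family of contractions for `re z > 0`. With `q` the truncated squared
distance to `x₀`, consider `F(w) = ⟪g, e^{-c₂ w q} A^{1/w} e^{c₁ w q} f⟫`, where `w` stands for
`1/s`. The truncation gives `|F(w)| ≤ ‖f‖ ‖g‖ e^{k re w}`, with `k` depending on the cutoff radius.
On the positive axis the Gaussian kernel absorbs both weights, so that `F` grows there only
polynomially. Phragmén–Lindelöf then yields `|F| ≤ ‖f‖ ‖g‖`, free of the radius, and the cutoff can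
be removed.

At almost every `x`, Cauchy–Schwarz for the kernel of `T r` bounds `|T t f (x)|` by a weighted norm
of `T s f` centred at `x`; the weighted estimate passes this to `f`, and `|f| ≤ 1` leaves a Gaussian
integral. Optimising the width of the weight gives `((1 + 1/√ε)/2)^{d/2}`, even without the factor
`2^{1/4}`. -/

noncomputable section

/-! ### Complex powers of a positive contraction -/

section OperatorPowers

lemma Real.rpow_mul_log_sq_le {r y : ℝ} (hr : 0 < r) (hr1 : r ≤ 1) (hy : 0 < y) :
    r ^ y * (Real.log r) ^ 2 ≤ 2 / y ^ 2 := by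
  have hL : Real.log r ≤ 0 := Real.log_nonpos hr.le hr1
  set v := -(y * Real.log r) with hv
  have hv0 : 0 ≤ v := by rw [hv]; nlinarith
  have h1 : v ^ 2 / 2 ≤ Real.exp v := by
    have := Real.quadratic_le_exp_of_nonneg hv0
    linarith
  have h2 : r ^ y = Real.exp (-v) := by rw [Real.rpow_def_of_pos hr, hv]; ring_nf
  rw [h2, Real.exp_neg, le_div_iff₀ (by positivity), inv_mul_eq_div, div_mul_eq_mul_div,
    div_le_iff₀ (Real.exp_pos _)]
  have : Real.log r ^ 2 * y ^ 2 = v ^ 2 := by rw [hv]; ring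
  linarith

/-- The Taylor remainder of `h ↦ r^{z+h}` carries `|h log r|² e^{|h log r|}`. Half of the decay of
`r^{re z}` pays for the exponential, the other half for `(log r)²`. Uniformity in `r` is what turns
this into norm differentiability of `A^z`. -/
lemma Complex.norm_cpow_add_sub_sub_le {r : ℝ} (hr : 0 ≤ r) (hr1 : r ≤ 1) {z h : ℂ}
    (hz : 0 < z.re) (hh : ‖h‖ ≤ z.re / 2) :
    ‖(r : ℂ) ^ (z + h) - (r : ℂ) ^ z - h * ((r : ℂ) ^ z * Complex.log r)‖
      ≤ 8 / z.re ^ 2 * ‖h‖ ^ 2 := by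
  have hre : -(z.re / 2) ≤ h.re := by
    have := Complex.abs_re_le_norm h
    have := neg_abs_le h.re
    linarith
  rcases hr.eq_or_lt with rfl | hr0
  · have h1 : z ≠ 0 := by rintro rfl; simp at hz
    have h2 : z + h ≠ 0 := by
      intro H
      have := congrArg Complex.re H
      simp at this
      linarith
    simp [Complex.zero_cpow h1, Complex.zero_cpow h2]
    positivity
  · have hrc : (r : ℂ) ≠ 0 := by exact_mod_cast hr0.ne'
    set L : ℂ := Complex.log r with hL
    have hLr : L = (Real.log r : ℝ) := by rw [hL, Complex.ofReal_log hr]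
    have hnL : ‖L‖ = -Real.log r := by
      rw [hLr, Complex.norm_real, Real.norm_eq_abs, abs_of_nonpos (Real.log_nonpos hr hr1)]
    have e1 : (r : ℂ) ^ (z + h) - (r : ℂ) ^ z - h * ((r : ℂ) ^ z * L)
        = (r : ℂ) ^ z * (Complex.exp (h * L) - ∑ m ∈ Finset.range 2, (h * L) ^ m / m.factorial) := by
      rw [Complex.cpow_add _ _ hrc, Complex.cpow_def_of_ne_zero hrc h, ← hL, mul_comm L h]
      simp [Finset.sum_range_succ]
      ring
    rw [e1, norm_mul, Complex.norm_cpow_eq_rpow_re_of_pos hr0]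
    have h2 := Complex.norm_exp_sub_sum_le_norm_mul_exp (h * L) 2
    have h3 : Real.exp ‖h * L‖ ≤ r ^ (-(z.re / 2)) := by
      rw [Real.rpow_def_of_pos hr0, norm_mul, hnL]
      apply Real.exp_le_exp.2
      nlinarith [Real.log_nonpos hr hr1]
    calc r ^ z.re * _ ≤ r ^ z.re * (‖h * L‖ ^ 2 * r ^ (-(z.re / 2))) := by gcongr; exact h2.trans (by gcongr)
      _ = (r ^ (z.re / 2) * (Real.log r) ^ 2) * ‖h‖ ^ 2 := by
        rw [norm_mul, hnL, mul_pow, neg_sq]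
        have : r ^ (z.re / 2) = r ^ z.re * r ^ (-(z.re / 2)) := by
          rw [← Real.rpow_add hr0]; ring_nf
        rw [this]; ring
      _ ≤ _ := by
        gcongr
        refine (Real.rpow_mul_log_sq_le hr0 hr1 (half_pos hz)).trans (le_of_eq ?_)
        field_simp; norm_num

lemma Complex.continuousOn_cpow_const_ofReal {z : ℂ} (hz : 0 < z.re) :
    ContinuousOn (fun l : ℂ => l ^ z) {l | ∃ r : ℝ, 0 ≤ r ∧ l = r} := by
  rintro l ⟨r, hr, rfl⟩
  exact (Complex.continuousAt_cpow_const_of_re_pos (Or.inl (by simpa using hr)) hz).continuousWithinAt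

lemma Complex.continuousOn_cpow_mul_log_ofReal {z : ℂ} (hz : 0 < z.re) :
    ContinuousOn (fun l : ℂ => l ^ z * Complex.log l) {l | ∃ r : ℝ, 0 ≤ r ∧ l = r} := by
  have hz0 : z ≠ 0 := by rintro rfl; simp at hz
  rintro l ⟨r, hr, rfl⟩
  rcases hr.eq_or_lt with rfl | hr0
  -- With `ρ = r ^ re z` one has `r ^ re z * log r = (ρ log ρ) / re z`, so continuity at `0` reduces
  -- to that of `ρ log ρ`.
  · have hc : Continuous fun l : ℂ => (1 / z.re) * ((l.re ^ z.re) * Real.log (l.re ^ z.re)) := by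
      have : Continuous fun l : ℂ => l.re ^ z.re :=
        Complex.continuous_re.rpow_const (fun _ => Or.inr hz.le)
      exact continuous_const.mul (Real.continuous_mul_log.comp this)
    have h0 := (hc.norm.tendsto 0).mono_left
      (nhdsWithin_le_nhds (s := {l : ℂ | ∃ r : ℝ, 0 ≤ r ∧ l = r}))
    have : (0 : ℝ) ^ z.re = 0 := Real.zero_rpow hz.ne'
    simp only [Complex.zero_re, this, Real.log_zero, mul_zero, norm_zero] at h0
    rw [ContinuousWithinAt]
    simp only [Complex.ofReal_zero, Complex.zero_cpow hz0, zero_mul]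
    rw [tendsto_zero_iff_norm_tendsto_zero]
    refine h0.congr' ?_
    filter_upwards [self_mem_nhdsWithin] with l hl
    obtain ⟨r, hr, rfl⟩ := hl
    rcases hr.eq_or_lt with rfl | hr0
    · simp [this, Complex.zero_cpow hz0]
    · rw [norm_mul (_ ^ _) (Complex.log _), Complex.norm_cpow_eq_rpow_re_of_pos hr0,
        ← Complex.ofReal_log hr, Complex.norm_real]
      simp only [Complex.ofReal_re, norm_mul, Real.log_rpow hr0]
      rw [Real.norm_of_nonneg (Real.rpow_nonneg hr _), Real.norm_of_nonneg (by positivity : 0 ≤ 1 / z.re),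
        Real.norm_of_nonneg hz.le]
      field_simp
  · have h1 : ContinuousAt (fun l : ℂ => l ^ z) r :=
      Complex.continuousAt_cpow_const_of_re_pos (Or.inl (by simpa using hr)) hz
    have h2 : ContinuousAt Complex.log (r : ℂ) :=
      continuousAt_clog (Complex.ofReal_mem_slitPlane.2 hr0)
    exact (h1.mul h2).continuousWithinAt

variable {X : Type*} [NormedAddCommGroup X] [InnerProductSpace ℂ X] [CompleteSpace X]

/-- The complex power `A ^ z` of a positive operator, for `0 < re z`. -/
def opPow (A : X →L[ℂ] X) (z : ℂ) : X →L[ℂ] X := cfc (fun l : ℂ => l ^ z) A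

/-- The derivative of `z ↦ A ^ z`. -/
def opPowLog (A : X →L[ℂ] X) (z : ℂ) : X →L[ℂ] X := cfc (fun l : ℂ => l ^ z * Complex.log l) A

variable {A : X →L[ℂ] X}

open scoped ComplexOrder in
lemma exists_eq_ofReal_of_mem_spectrum (hA : 0 ≤ A) {l : ℂ} (hl : l ∈ spectrum ℂ A) :
    ∃ r : ℝ, 0 ≤ r ∧ r ≤ ‖A‖ ∧ l = r := by
  have h0 : 0 ≤ l := spectrum_nonneg_of_nonneg hA hl
  refine ⟨l.re, (Complex.nonneg_iff.1 h0).1, ?_, ?_⟩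
  · refine (Complex.re_le_norm l).trans ((spectrum.norm_le_norm_mul_of_mem hl).trans ?_)
    exact mul_le_of_le_one_right (norm_nonneg _) ContinuousLinearMap.norm_id_le
  · apply Complex.ext <;> simp [(Complex.nonneg_iff.1 h0).2.symm]

lemma spectrum_subset_ofReal (hA : 0 ≤ A) : spectrum ℂ A ⊆ {l | ∃ r : ℝ, 0 ≤ r ∧ l = r} :=
  fun _ hl => let ⟨r, h0, _, h⟩ := exists_eq_ofReal_of_mem_spectrum hA hl; ⟨r, h0, h⟩

lemma continuousOn_cpow_spectrum (hA : 0 ≤ A) {z : ℂ} (hz : 0 < z.re) :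
    ContinuousOn (fun l : ℂ => l ^ z) (spectrum ℂ A) :=
  (Complex.continuousOn_cpow_const_ofReal hz).mono (spectrum_subset_ofReal hA)

lemma continuousOn_cpow_mul_log_spectrum (hA : 0 ≤ A) {z : ℂ} (hz : 0 < z.re) :
    ContinuousOn (fun l : ℂ => l ^ z * Complex.log l) (spectrum ℂ A) :=
  (Complex.continuousOn_cpow_mul_log_ofReal hz).mono (spectrum_subset_ofReal hA)

lemma norm_opPow_le_one (hA : 0 ≤ A) (hA1 : ‖A‖ ≤ 1) {z : ℂ} (hz : 0 < z.re) :
    ‖opPow A z‖ ≤ 1 := by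
  refine norm_cfc_le zero_le_one fun l hl => ?_
  obtain ⟨r, h0, h1, rfl⟩ := exists_eq_ofReal_of_mem_spectrum hA hl
  rw [Complex.norm_cpow_eq_rpow_re_of_nonneg h0 hz.ne']
  exact Real.rpow_le_one h0 (h1.trans hA1) hz.le

/-- On the spectrum this is `n |log r| ≤ e^{n |log r|} = r^{-n}`. The decay in `n` drives the
contradiction in `norm_ne_of_leftInverse`. -/
lemma norm_opPowLog_natCast_le (hA : 0 ≤ A) (hA1 : ‖A‖ ≤ 1) {n : ℕ} (hn : 0 < n) :
    ‖opPowLog A n‖ ≤ 1 / n := by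
  refine norm_cfc_le (by positivity) fun l hl => ?_
  obtain ⟨r, h0, h1, rfl⟩ := exists_eq_ofReal_of_mem_spectrum hA hl
  rw [norm_mul, Complex.cpow_natCast, norm_pow, Complex.norm_real, ← Complex.ofReal_log h0,
    Complex.norm_real, Real.norm_of_nonneg h0, Real.norm_eq_abs,
    abs_of_nonpos (Real.log_nonpos h0 (h1.trans hA1))]
  rcases h0.eq_or_lt with rfl | hr0
  · simp [hn.ne']
  · have h2 := Real.add_one_le_exp (n * -Real.log r)
    have h3 : Real.exp (n * -Real.log r) * r ^ n = 1 := by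
      rw [mul_neg, Real.exp_neg, ← Real.log_pow, Real.exp_log (by positivity)]
      field_simp
    have hn' : (0 : ℝ) < n := by exact_mod_cast hn
    rw [le_div_iff₀ hn']
    have h4 : 0 < r ^ n := by positivity
    nlinarith

theorem hasDerivAt_opPow (hA : 0 ≤ A) (hA1 : ‖A‖ ≤ 1) {z : ℂ} (hz : 0 < z.re) :
    HasDerivAt (opPow A) (opPowLog A z) z := by
  rw [hasDerivAt_iff_isLittleO_nhds_zero]
  have key : (fun h : ℂ => opPow A (z + h) - opPow A z - h • opPowLog A z)
      =O[𝓝 0] fun h : ℂ => ‖h‖ ^ 2 := by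
    refine Asymptotics.IsBigO.of_bound (8 / z.re ^ 2) ?_
    filter_upwards [Metric.closedBall_mem_nhds (0 : ℂ) (half_pos hz)] with h hh
    have hh' : ‖h‖ ≤ z.re / 2 := by simpa using hh
    have hzh : 0 < (z + h).re := by
      have := Complex.abs_re_le_norm h
      have := neg_abs_le h.re
      simp only [Complex.add_re]
      linarith
    have c1 := continuousOn_cpow_spectrum hA hz
    have c2 := continuousOn_cpow_spectrum hA hzh
    have c3 := continuousOn_cpow_mul_log_spectrum hA hz
    have e : opPow A (z + h) - opPow A z - h • opPowLog A z
        = cfc (fun l : ℂ => l ^ (z + h) - l ^ z - h • (l ^ z * Complex.log l)) A := by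
      have e1 := cfc_sub (fun l : ℂ => l ^ (z + h)) (fun l : ℂ => l ^ z) A c2 c1
      have e2 := cfc_smul h (fun l : ℂ => l ^ z * Complex.log l) A c3
      have e3 := cfc_sub (fun l : ℂ => l ^ (z + h) - l ^ z)
        (fun l : ℂ => h • (l ^ z * Complex.log l)) A (c2.sub c1) (c3.const_smul h)
      rw [e3, e1, e2]
      rfl
    rw [e, norm_pow, norm_norm]
    refine norm_cfc_le (by positivity) fun l hl => ?_
    obtain ⟨r, h0, h1, rfl⟩ := exists_eq_ofReal_of_mem_spectrum hA hl
    exact Complex.norm_cpow_add_sub_sub_le h0 (h1.trans hA1) hz hh'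
  refine key.trans_isLittleO ?_
  simpa using (Asymptotics.isLittleO_norm_pow_id (E' := ℂ) one_lt_two)

lemma opPow_natCast (hA : 0 ≤ A) (n : ℕ) : opPow A n = A ^ n := by
  have : IsStarNormal A := (IsSelfAdjoint.of_nonneg hA).isStarNormal
  simp only [opPow, Complex.cpow_natCast]
  exact cfc_pow_id A n

lemma opPow_natCast_mul (hA : 0 ≤ A) {z : ℂ} (hz : 0 < z.re) (n : ℕ) :
    opPow A (n * z) = opPow A z ^ n := by
  have : IsStarNormal A := (IsSelfAdjoint.of_nonneg hA).isStarNormal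
  have c1 := continuousOn_cpow_spectrum hA hz
  rw [opPow, opPow, ← cfc_pow _ _ A c1]
  refine cfc_congr fun l _ => ?_
  exact Complex.cpow_nat_mul l n z

lemma opPow_inv_natCast_pow (hA : 0 ≤ A) {n : ℕ} (hn : n ≠ 0) :
    opPow (A ^ n) (n : ℂ)⁻¹ = A := by
  have : IsStarNormal A := (IsSelfAdjoint.of_nonneg hA).isStarNormal
  have hn' : 0 < ((n : ℂ)⁻¹).re := by
    rw [← Complex.ofReal_natCast, ← Complex.ofReal_inv, Complex.ofReal_re]; positivity
  have hc : ContinuousOn (fun l : ℂ => l ^ (n : ℂ)⁻¹) ((fun l => l ^ n) '' spectrum ℂ A) := by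
    refine (Complex.continuousOn_cpow_const_ofReal hn').mono ?_
    rintro _ ⟨l, hl, rfl⟩
    obtain ⟨r, h0, h1, rfl⟩ := exists_eq_ofReal_of_mem_spectrum hA hl
    exact ⟨r ^ n, by positivity, by simp⟩
  rw [opPow, ← cfc_comp_pow (fun l : ℂ => l ^ (n : ℂ)⁻¹) n A hc]
  conv_rhs => rw [← cfc_id ℂ A]
  refine cfc_congr fun l hl => ?_
  obtain ⟨r, h0, h1, rfl⟩ := exists_eq_ofReal_of_mem_spectrum hA hl
  simp only [id]
  rw [← Complex.ofReal_pow, ← Complex.ofReal_natCast, ← Complex.ofReal_inv,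
    ← Complex.ofReal_cpow (by positivity), Real.pow_rpow_inv_natCast h0 hn]

lemma opPow_add (hA : 0 ≤ A) {z w : ℂ} (hz : 0 < z.re) (hw : 0 < w.re) :
    opPow A (z + w) = opPow A z * opPow A w := by
  rw [opPow, opPow, opPow, ← cfc_mul _ _ A (continuousOn_cpow_spectrum hA hz)
    (continuousOn_cpow_spectrum hA hw)]
  refine cfc_congr fun l hl => ?_
  obtain ⟨r, h0, h1, rfl⟩ := exists_eq_ofReal_of_mem_spectrum hA hl
  rcases h0.eq_or_lt with rfl | hr0
  · have h1 : z ≠ 0 := by rintro rfl; simp at hz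
    have h3 : z + w ≠ 0 := by
      intro H
      have := congrArg Complex.re H
      simp at this
      linarith
    simp [Complex.zero_cpow h1, Complex.zero_cpow h3]
  · exact Complex.cpow_add _ _ (by exact_mod_cast hr0.ne')

end OperatorPowers

/-! ### C₀-semigroups: continuity, selfadjointness, spectral form -/

section Semigroups

variable {X : Type*} [NormedAddCommGroup X]

section Banach

variable [NormedSpace ℂ X] {T : ℝ → X →L[ℂ] X}

/-- `f` lies in the domain of the generator of `T`, with image `g`. -/
def HasRightDeriv (T : ℝ → X →L[ℂ] X) (f g : X) : Prop :=
  Tendsto (fun h : ℝ => ((h⁻¹ : ℝ) : ℂ) • (T h f - f)) (𝓝[>] 0) (𝓝 g)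

lemma IsGenerator.hasRightDeriv_iff {H : X →ₗ.[ℂ] X} (hgen : IsGenerator T (-H)) {f g : X} :
    HasRightDeriv T f g ↔ ∃ u : H.domain, (u : X) = f ∧ -H u = g :=
  (hgen f g).symm.trans (LinearPMap.mem_graph_iff _)

namespace IsC0Semigroup

lemma add_apply (hT : IsC0Semigroup T) {s t : ℝ} (hs : 0 ≤ s) (ht : 0 ≤ t) (f : X) :
    T (s + t) f = T s (T t f) := by rw [hT.add s t hs ht]; rfl

lemma tendsto_nhdsGE (hT : IsC0Semigroup T) (f : X) :
    Tendsto (fun t => T t f) (𝓝[≥] 0) (𝓝 f) := by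
  rw [← Set.Ioi_insert, nhdsWithin_insert, tendsto_sup]
  refine ⟨?_, hT.strongly_continuous f⟩
  rw [tendsto_pure_left]
  intro s hs
  simpa [hT.zero] using mem_of_mem_nhds hs

/-- Otherwise `‖T (s n)‖ > n` along some `s n → 0`, against Banach–Steinhaus, since each orbit
converges along `s n`. -/
lemma exists_bound_near_zero [CompleteSpace X] (hT : IsC0Semigroup T) :
    ∃ δ > 0, ∃ C : ℝ, ∀ s ∈ Set.Icc 0 δ, ‖T s‖ ≤ C := by
  by_contra! H
  choose s hs hC using fun n : ℕ => H (1 / (n + 1 : ℝ)) (by positivity) n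
  have hs0 : Tendsto s atTop (𝓝[≥] 0) := by
    refine tendsto_nhdsWithin_iff.2 ⟨?_, Eventually.of_forall fun n => (hs n).1⟩
    exact squeeze_zero (fun n => (hs n).1) (fun n => (hs n).2) tendsto_one_div_add_atTop_nhds_zero_nat
  obtain ⟨C, hC'⟩ := banach_steinhaus (g := fun n => T (s n)) fun f => by
    obtain ⟨C, hC⟩ := ((hT.tendsto_nhdsGE f).comp hs0).norm.bddAbove_range
    exact ⟨C, fun n => hC ⟨n, rfl⟩⟩
  obtain ⟨n, hn⟩ := exists_nat_gt C
  linarith [hC n, hC' n]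

lemma exists_bound [CompleteSpace X] (hT : IsC0Semigroup T) (t : ℝ) :
    ∃ C : ℝ, ∀ s ∈ Set.Icc 0 t, ‖T s‖ ≤ C := by
  obtain ⟨δ, hδ, C, hC⟩ := hT.exists_bound_near_zero
  have key : ∀ n : ℕ, ∃ C' : ℝ, ∀ s ∈ Set.Icc 0 (n * δ), ‖T s‖ ≤ C' := by
    intro n
    induction n with
    | zero => exact ⟨‖T 0‖, fun s hs => by
        have : s = 0 := le_antisymm (by simpa using hs.2) hs.1
        rw [this]⟩
    | succ n ih =>
      obtain ⟨C', hC'⟩ := ih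
      refine ⟨max C (C * C'), fun s hs => ?_⟩
      rcases le_total s δ with h | h
      · exact (hC s ⟨hs.1, h⟩).trans (le_max_left _ _)
      · refine le_trans ?_ (le_max_right _ _)
        have h2 := hs.2
        push_cast at h2
        have e : s = δ + (s - δ) := by ring
        rw [e, hT.add _ _ hδ.le (by linarith)]
        refine (ContinuousLinearMap.opNorm_comp_le _ _).trans ?_
        exact mul_le_mul (hC δ ⟨hδ.le, le_rfl⟩) (hC' _ ⟨by linarith, by linarith⟩)
          (norm_nonneg _) ((norm_nonneg _).trans (hC δ ⟨hδ.le, le_rfl⟩))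
  obtain ⟨n, hn⟩ := exists_nat_ge (t / δ)
  obtain ⟨C', hC'⟩ := key n
  exact ⟨C', fun s hs => hC' s ⟨hs.1, hs.2.trans ((div_le_iff₀ hδ).1 hn)⟩⟩

lemma norm_sub_le (hT : IsC0Semigroup T) {t C : ℝ} (hC : ∀ s ∈ Set.Icc 0 t, ‖T s‖ ≤ C)
    {r s : ℝ} (hr : r ∈ Set.Icc 0 t) (hs : s ∈ Set.Icc 0 t) (f : X) :
    ‖T r f - T s f‖ ≤ C * ‖T |r - s| f - f‖ := by
  wlog h : s ≤ r generalizing r s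
  · rw [norm_sub_rev, abs_sub_comm]
    exact this hs hr (le_of_not_ge h)
  · have e : r = s + |r - s| := by rw [abs_of_nonneg (sub_nonneg.2 h)]; ring
    calc ‖T r f - T s f‖ = ‖T s (T |r - s| f - f)‖ := by
          rw [map_sub, ← hT.add_apply hs.1 (abs_nonneg _), ← e]
      _ ≤ _ := (T s).le_of_opNorm_le (hC s hs) _

lemma continuousOn [CompleteSpace X] (hT : IsC0Semigroup T) (f : X) (t : ℝ) :
    ContinuousOn (fun s => T s f) (Set.Icc 0 t) := by
  obtain ⟨C, hC⟩ := hT.exists_bound t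
  intro s hs
  rw [ContinuousWithinAt, tendsto_iff_norm_sub_tendsto_zero]
  have h1 : Tendsto (fun r => |r - s|) (𝓝[Set.Icc 0 t] s) (𝓝[≥] 0) := by
    refine tendsto_nhdsWithin_iff.2 ⟨?_, Eventually.of_forall fun n => abs_nonneg (n - s)⟩
    have : Continuous fun r : ℝ => |r - s| := by fun_prop
    simpa using (this.tendsto s).mono_left nhdsWithin_le_nhds
  have h2 := (tendsto_iff_norm_sub_tendsto_zero.1 ((hT.tendsto_nhdsGE f).comp h1)).const_mul C
  rw [mul_zero] at h2
  refine squeeze_zero' (Eventually.of_forall fun _ => norm_nonneg _) ?_ h2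
  filter_upwards [self_mem_nhdsWithin] with r hr
  exact hT.norm_sub_le hC hr hs f

lemma tendsto_apply [CompleteSpace X] (hT : IsC0Semigroup T) {ι : Type*} {l : Filter ι} {t τ : ℝ}
    {s : ι → ℝ} {f : ι → X} {g : X} (hs : Tendsto s l (𝓝[Set.Icc 0 t] τ)) (hτ : τ ∈ Set.Icc 0 t)
    (hf : Tendsto f l (𝓝 g)) : Tendsto (fun i => T (s i) (f i)) l (𝓝 (T τ g)) := by
  obtain ⟨C, hC⟩ := hT.exists_bound t
  have h1 : Tendsto (fun i => T (s i) g) l (𝓝 (T τ g)) := (hT.continuousOn g t τ hτ).tendsto.comp hs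
  have h2 : Tendsto (fun i => T (s i) (f i - g)) l (𝓝 0) := by
    have h3 := (tendsto_iff_norm_sub_tendsto_zero.1 hf).const_mul C
    rw [mul_zero] at h3
    refine squeeze_zero_norm' ?_ h3
    filter_upwards [tendsto_nhdsWithin_iff.1 hs |>.2] with i hi
    exact (T (s i)).le_of_opNorm_le (hC _ hi) _
  simpa using h2.add h1

lemma hasRightDeriv_apply (hT : IsC0Semigroup T) {f g : X} (h : HasRightDeriv T f g) {s : ℝ}
    (hs : 0 ≤ s) : HasRightDeriv T (T s f) (T s g) := by
  refine (((T s).continuous.tendsto g).comp h).congr' ?_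
  filter_upwards [self_mem_nhdsWithin] with r hr
  have hr' : 0 ≤ r := le_of_lt hr
  simp only [Function.comp, map_smul, map_sub]
  rw [← hT.add_apply hs hr', ← hT.add_apply hr' hs, add_comm]

lemma smul_exp (hT : IsC0Semigroup T) (c : ℝ) :
    IsC0Semigroup fun t => ((Real.exp (-(c * t)) : ℝ) : ℂ) • T t where
  zero := by simp [hT.zero]
  add s t hs ht := by
    ext f
    simp only [smul_apply, ContinuousLinearMap.comp_apply, map_smul,
      smul_smul, hT.add_apply hs ht, ← Complex.ofReal_mul, ← Real.exp_add]
    congr 4; ring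
  strongly_continuous f := by
    have : Continuous fun t : ℝ => ((Real.exp (-(c * t)) : ℝ) : ℂ) := by fun_prop
    simpa using ((this.tendsto 0).mono_left nhdsWithin_le_nhds).smul (hT.strongly_continuous f)

lemma pow_apply_mul (hT : IsC0Semigroup T) {t : ℝ} (ht : 0 ≤ t) (n : ℕ) :
    T (n * t) = T t ^ n := by
  induction n with
  | zero => simp [hT.zero]; rfl
  | succ n ih =>
    rw [pow_succ, ← ih, Nat.cast_succ, add_mul, one_mul, hT.add _ _ (by positivity) ht]
    rfl

end IsC0Semigroup

end Banach

section Hilbert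

variable [InnerProductSpace ℂ X] [CompleteSpace X] {T : ℝ → X →L[ℂ] X}

local notation "⟪" x ", " y "⟫" => inner ℂ x y

namespace IsC0Semigroup

/-- The function `s ↦ ⟪T (t - s) u, T s v⟫` has zero right derivative by symmetry of the generator,
hence is constant; its values at the endpoints are the two sides. -/
theorem inner_apply_eq_of_hasRightDeriv (hT : IsC0Semigroup T)
    (hsym : ∀ u v u' v', HasRightDeriv T u u' → HasRightDeriv T v v' → ⟪u', v⟫ = ⟪u, v'⟫)
    {u v u' v' : X} (hu : HasRightDeriv T u u') (hv : HasRightDeriv T v v') {t : ℝ} (ht : 0 ≤ t) :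
    ⟪T t u, v⟫ = ⟪u, T t v⟫ := by
  have hcont : ContinuousOn (fun s => ⟪T (t - s) u, T s v⟫) (Set.Icc 0 t) := by
    refine ContinuousOn.inner ?_ (hT.continuousOn v t)
    refine (hT.continuousOn u t).comp (by fun_prop) fun s hs => ⟨?_, ?_⟩ <;> linarith [hs.1, hs.2]
  have hder : ∀ s ∈ Set.Ico 0 t,
      HasDerivWithinAt (fun s => ⟪T (t - s) u, T s v⟫) 0 (Set.Ici s) s := by
    intro s hs
    rw [← hasDerivWithinAt_Ioi_iff_Ici, hasDerivWithinAt_iff_tendsto_slope' (by simp)]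
    have hmap : Tendsto (fun r => r - s) (𝓝[>] s) (𝓝[>] 0) := by
      refine tendsto_nhdsWithin_iff.2 ⟨?_, ?_⟩
      · have : Continuous fun r : ℝ => r - s := by fun_prop
        simpa using (this.tendsto s).mono_left nhdsWithin_le_nhds
      · filter_upwards [self_mem_nhdsWithin] with r hr
        simpa using hr
    have hτ : Tendsto (fun r => t - r) (𝓝[>] s) (𝓝[Set.Icc 0 t] (t - s)) := by
      refine tendsto_nhdsWithin_iff.2 ⟨?_, ?_⟩
      · have : Continuous fun r : ℝ => t - r := by fun_prop
        exact (this.tendsto s).mono_left nhdsWithin_le_nhds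
      · filter_upwards [Ioo_mem_nhdsGT hs.2] with r hr
        constructor <;> linarith [hr.1, hr.2, hs.1]
    have hts : t - s ∈ Set.Icc 0 t := ⟨by linarith [hs.2], by linarith [hs.1]⟩
    have l1 := (hT.tendsto_apply hτ hts (tendsto_const_nhds (x := u))).inner (𝕜 := ℂ)
      ((hT.hasRightDeriv_apply hv hs.1).comp hmap)
    have l2 := (hT.tendsto_apply hτ hts (hu.comp hmap)).inner (𝕜 := ℂ)
      (tendsto_const_nhds (x := T s v))
    have l3 := l1.sub l2
    rw [hsym _ _ _ _ (hT.hasRightDeriv_apply hu hts.1) (hT.hasRightDeriv_apply hv hs.1),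
      sub_self] at l3
    refine l3.congr' ?_
    filter_upwards [Ioo_mem_nhdsGT hs.2] with r hr
    have hr1 : 0 ≤ r - s := by linarith [hr.1]
    have hr2 : 0 ≤ t - r := by linarith [hr.2]
    -- Both increments become forward quotients with step `r - s`, so no left derivative of an orbit
    -- is needed.
    have e1 : T r v = T (r - s) (T s v) := by
      rw [← hT.add_apply hr1 hs.1]; congr 2; ring
    have e2 : T (t - s) u = T (t - r) (T (r - s) u) := by
      rw [← hT.add_apply hr2 hr1]; congr 2; ring
    simp only [Function.comp, slope_def_module, e1, e2, map_smul, map_sub, inner_smul_right,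
      inner_smul_left, inner_sub_left, inner_sub_right, Complex.conj_ofReal, Complex.real_smul]
    ring
  have h := constant_of_has_deriv_right_zero hcont hder t ⟨ht, le_rfl⟩
  simpa [hT.zero] using h.symm

theorem isSelfAdjoint (hT : IsC0Semigroup T)
    (hsym : ∀ u v u' v', HasRightDeriv T u u' → HasRightDeriv T v v' → ⟪u', v⟫ = ⟪u, v'⟫)
    (hdense : Dense {u | ∃ u', HasRightDeriv T u u'}) {t : ℝ} (ht : 0 ≤ t) :
    IsSelfAdjoint (T t) := by
  rw [ContinuousLinearMap.isSelfAdjoint_iff_isSymmetric]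
  have h1 : ∀ u ∈ {u | ∃ u', HasRightDeriv T u u'}, ∀ v, ⟪T t u, v⟫ = ⟪u, T t v⟫ := by
    rintro u ⟨u', hu⟩
    refine fun v => congrFun (Continuous.ext_on (f := fun v => ⟪T t u, v⟫)
      (g := fun v => ⟪u, T t v⟫) hdense (by fun_prop) (by fun_prop) ?_) v
    rintro v ⟨v', hv⟩
    exact hT.inner_apply_eq_of_hasRightDeriv hsym hu hv ht
  intro u v
  exact congrFun (Continuous.ext_on (f := fun u => ⟪T t u, v⟫)
      (g := fun u => ⟪u, T t v⟫) hdense (by fun_prop) (by fun_prop) fun u hu => h1 u hu v) u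

theorem nonneg_of_isSelfAdjoint (hT : IsC0Semigroup T)
    (hsa : ∀ t, 0 ≤ t → IsSelfAdjoint (T t)) {t : ℝ} (ht : 0 ≤ t) : 0 ≤ T t := by
  have e : T t = star (T (t / 2)) * T (t / 2) := by
    rw [(hsa (t / 2) (by positivity)).star_eq]
    conv_lhs => rw [← add_halves t, hT.add _ _ (by positivity) (by positivity)]
    rfl
  rw [e]
  exact star_mul_self_nonneg _

/-- A semigroup of positive operators consists of the powers of `T 1`. -/
theorem eq_opPow (hT : IsC0Semigroup T) (hpos : ∀ t, 0 ≤ t → 0 ≤ T t) (h1 : ‖T 1‖ ≤ 1)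
    {t : ℝ} (ht : 0 < t) : T t = opPow (T 1) t := by
  -- `T (1/m)` is a positive `m`-th root of `T 1`, hence equals `(T 1)^{1/m}`; its powers give all
  -- positive rationals.
  have hrat : ∀ q : ℚ, 0 < q → T q = opPow (T 1) (q : ℂ) := by
    intro q hq
    have hd : (q.den : ℝ) ≠ 0 := by exact_mod_cast q.den_nz
    have hpow : T 1 = T (q.den : ℝ)⁻¹ ^ q.den := by
      rw [← hT.pow_apply_mul (by positivity), mul_inv_cancel₀ hd]
    have hroot : opPow (T 1) (q.den : ℂ)⁻¹ = T (q.den : ℝ)⁻¹ := by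
      rw [hpow, opPow_inv_natCast_pow (hpos _ (by positivity)) q.den_nz]
    have hnum : ((q.num.toNat : ℕ) : ℤ) = q.num := Int.toNat_of_nonneg (Rat.num_pos.2 hq).le
    have hre : 0 < ((q.den : ℂ)⁻¹).re := by
      rw [← Complex.ofReal_natCast, ← Complex.ofReal_inv, Complex.ofReal_re]
      have := q.den_pos
      positivity
    have eR : (q : ℝ) = (q.num.toNat : ℝ) * (q.den : ℝ)⁻¹ := by
      rw [← div_eq_mul_inv, ← Int.cast_natCast q.num.toNat, hnum, ← Rat.cast_def]
    have eC : (q : ℂ) = (q.num.toNat : ℂ) * (q.den : ℂ)⁻¹ := by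
      rw [← div_eq_mul_inv, ← Int.cast_natCast q.num.toNat, hnum, ← Rat.cast_def]
    rw [eC, opPow_natCast_mul (hpos 1 zero_le_one) hre, hroot, eR,
      hT.pow_apply_mul (by positivity)]
  ext f
  have l1 : Tendsto (fun s => T s f) (𝓝[>] t) (𝓝 (T t f)) :=
    ((hT.continuousOn f (t + 1)) t ⟨ht.le, by linarith⟩).tendsto.mono_left
      (nhdsWithin_le_of_mem (Icc_mem_nhdsGT_of_mem ⟨ht.le, by linarith⟩))
  have l2 : Tendsto (fun s : ℝ => opPow (T 1) s f) (𝓝[>] t) (𝓝 (opPow (T 1) t f)) := by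
    have hd := (hasDerivAt_opPow (hpos 1 zero_le_one) h1 (z := t) (by simpa using ht)).continuousAt
    have h2 : Tendsto (fun s : ℝ => opPow (T 1) (s : ℂ)) (𝓝 t) (𝓝 (opPow (T 1) t)) :=
      hd.tendsto.comp (Complex.continuous_ofReal.tendsto t)
    exact ((ContinuousLinearMap.apply ℂ X f).continuous.tendsto _).comp
      (h2.mono_left nhdsWithin_le_nhds)
  refine tendsto_nhds_unique_of_frequently_eq l1 l2 ?_
  rw [frequently_iff]
  intro U hU
  obtain ⟨b, hb, hbU⟩ := (mem_nhdsGT_iff_exists_Ioo_subset).1 hU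
  obtain ⟨q, hq1, hq2⟩ := exists_rat_btwn (Set.mem_Ioi.1 hb)
  refine ⟨q, hbU ⟨hq1, hq2⟩, ?_⟩
  have hq : (0 : ℚ) < q := by exact_mod_cast ht.trans hq1
  simp [hrat q hq]

lemma exp_smul_nonneg {B : X →L[ℂ] X} (c : ℝ) (hB : 0 ≤ B) :
    0 ≤ ((Real.exp c : ℝ) : ℂ) • B := by
  have : ((Real.exp c : ℝ) : ℂ) • B = Real.exp c • B := by
    ext f
    exact Complex.coe_smul _ _
  rw [this]
  exact smul_nonneg (Real.exp_pos _).le hB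

/-- A semigroup of positive operators with `‖T 1‖ ≤ e ^ (-E)` is, up to the factor `e ^ (-E t)`,
given by the powers of a positive contraction. -/
theorem exists_eq_exp_smul_opPow (hT : IsC0Semigroup T) (hpos : ∀ t, 0 ≤ t → 0 ≤ T t) {E : ℝ}
    (h1 : ‖T 1‖ ≤ Real.exp (-E)) : ∃ A : X →L[ℂ] X, 0 ≤ A ∧ ‖A‖ ≤ 1 ∧
      ∀ t : ℝ, 0 < t → T t = ((Real.exp (-(E * t)) : ℝ) : ℂ) • opPow A t := by
  have hS := hT.smul_exp (-E)
  have hSpos : ∀ t, 0 ≤ t → 0 ≤ ((Real.exp (-(-E * t)) : ℝ) : ℂ) • T t :=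
    fun t ht => exp_smul_nonneg _ (hpos t ht)
  have hS1 : ‖((Real.exp (-(-E * 1)) : ℝ) : ℂ) • T 1‖ ≤ 1 := by
    rw [norm_smul, Complex.norm_real, Real.norm_of_nonneg (Real.exp_pos _).le]
    calc _ ≤ Real.exp (-(-E * 1)) * Real.exp (-E) := by gcongr
      _ = 1 := by rw [← Real.exp_add]; simp
  refine ⟨_, hSpos 1 zero_le_one, hS1, fun t ht => ?_⟩
  rw [← hS.eq_opPow hSpos hS1 ht, smul_smul, ← Complex.ofReal_mul, ← Real.exp_add]
  simp

/-- If `-r` is in the resolvent set of the negative of the generator, then a semigroup of positive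
operators cannot have `‖T 1‖ = e ^ r`. -/
theorem norm_ne_of_leftInverse (hT : IsC0Semigroup T) (hpos : ∀ t, 0 ≤ t → 0 ≤ T t) {r : ℝ}
    (R : X →L[ℂ] X) (hR : ∀ u g, HasRightDeriv T u g → R (g - (r : ℂ) • u) = u) :
    ‖T 1‖ ≠ Real.exp r := by
  intro hr
  set S : ℝ → X →L[ℂ] X := fun t => ((Real.exp (-(r * t)) : ℝ) : ℂ) • T t with hSdef
  have hS : IsC0Semigroup S := hT.smul_exp r
  have hS1 : ‖S 1‖ = 1 := by
    simp only [hSdef, mul_one, norm_smul, hr, Complex.norm_real, Real.norm_eq_abs, Real.abs_exp]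
    rw [← Real.exp_add]; simp
  have hSpos : ∀ t, 0 ≤ t → 0 ≤ S t := by
    intro t ht
    exact exp_smul_nonneg _ (hpos t ht)
  -- The vector `u = (S 1)^n f` lies in the domain of the generator of `S`, with image `(S 1)^n log
  -- (S 1) f`; undoing the rescaling, `R` must recover `u` from that image.
  have hkey : ∀ n : ℕ, 0 < n → ∀ f, R (opPowLog (S 1) n f) = opPow (S 1) n f := by
    intro n hn f
    set u := opPow (S 1) n f with hu
    have hn' : (0 : ℝ) < n := by exact_mod_cast hn
    have hd : HasDerivAt (fun s : ℝ => opPow (S 1) s f) (opPowLog (S 1) n f) n := by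
      have h1 := (hasDerivAt_opPow (hSpos 1 zero_le_one) hS1.le (z := (n : ℝ))
        (by simpa using hn')).scomp (n : ℝ) Complex.ofRealCLM.hasDerivAt
      have h2 := (((ContinuousLinearMap.apply ℂ X f).restrictScalars ℝ).hasFDerivAt).comp_hasDerivAt
        (n : ℝ) h1
      simpa [Function.comp_def] using h2
    have hSu : HasRightDeriv S u (opPowLog (S 1) n f) := by
      have h1 := (hasDerivAt_iff_tendsto_slope_zero.1 hd).mono_left
        (nhdsWithin_mono 0 (s := Set.Ioi 0) fun x hx => ne_of_gt hx)
      refine h1.congr' ?_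
      filter_upwards [self_mem_nhdsWithin] with h hh
      have hh' : (0 : ℝ) < h := hh
      have hre : 0 < ((n : ℝ) : ℂ).re := by simpa using hn'
      have e : opPow (S 1) ((n + h : ℝ) : ℂ) = S h * opPow (S 1) n := by
        rw [add_comm, Complex.ofReal_add, opPow_add (hSpos 1 zero_le_one)
          (by simpa using hh') hre, ← hS.eq_opPow hSpos hS1.le hh', Complex.ofReal_natCast]
      rw [e, hu, Complex.ofReal_natCast, Complex.coe_smul]
      rfl
    have hTu : HasRightDeriv T u (opPowLog (S 1) n f + (r : ℂ) • u) := by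
      have c1 : Tendsto (fun h : ℝ => ((Real.exp (r * h) : ℝ) : ℂ)) (𝓝[>] 0) (𝓝 1) := by
        have : Continuous fun t : ℝ => ((Real.exp (r * t) : ℝ) : ℂ) := by fun_prop
        simpa using (this.tendsto 0).mono_left nhdsWithin_le_nhds
      have c2 : Tendsto (fun h : ℝ => ((h⁻¹ * (Real.exp (r * h) - 1) : ℝ) : ℂ)) (𝓝[>] 0)
          (𝓝 (r : ℂ)) := by
        have hd : HasDerivAt (fun h : ℝ => Real.exp (r * h)) r 0 := by
          simpa using ((hasDerivAt_id (0 : ℝ)).const_mul r).exp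
        have h1 := (hasDerivAt_iff_tendsto_slope_zero.1 hd).mono_left
          (nhdsWithin_mono 0 (s := Set.Ioi 0) fun x hx => ne_of_gt hx)
        have h2 := (Complex.continuous_ofReal.tendsto r).comp h1
        simpa [Function.comp_def] using h2
      have h3 := (c1.smul hSu).add (c2.smul (tendsto_const_nhds (x := u)))
      rw [one_smul] at h3
      refine h3.congr' (Eventually.of_forall fun h => ?_)
      have e : T h u = ((Real.exp (r * h) : ℝ) : ℂ) • S h u := by
        simp only [hSdef, smul_apply, smul_smul, ← Complex.ofReal_mul,
          ← Real.exp_add]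
        simp
      simp only [e, Complex.ofReal_mul, Complex.ofReal_sub, Complex.ofReal_one]
      module
    have := hR _ _ hTu
    simpa using this
  -- For exponents `2 ^ k` the C*-identity gives `‖(S 1)^n‖ = 1` exactly, while the preimage under
  -- `R` has operator norm at most `1/n`: no bounded `R` allows this for all `k`.
  have hnorm : ∀ k : ℕ, 1 ≤ ‖R‖ * (1 / (2 ^ k : ℕ)) := by
    intro k
    have hn : 0 < 2 ^ k := by positivity
    have e : R.comp (opPowLog (S 1) (2 ^ k : ℕ)) = opPow (S 1) (2 ^ k : ℕ) := by
      ext f; exact hkey _ hn f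
    have h1 : ‖opPow (S 1) (2 ^ k : ℕ)‖ = 1 := by
      rw [opPow_natCast (hSpos 1 zero_le_one),
        (IsSelfAdjoint.of_nonneg (hSpos 1 zero_le_one)).norm_pow_two_pow, hS1, one_pow]
    calc (1 : ℝ) = ‖R.comp (opPowLog (S 1) (2 ^ k : ℕ))‖ := by rw [e, h1]
      _ ≤ ‖R‖ * ‖opPowLog (S 1) (2 ^ k : ℕ)‖ := ContinuousLinearMap.opNorm_comp_le _ _
      _ ≤ _ := by
        gcongr
        exact norm_opPowLog_natCast_le (hSpos 1 zero_le_one) hS1.le hn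
  obtain ⟨k, hk⟩ := pow_unbounded_of_one_lt ‖R‖ (one_lt_two (α := ℝ))
  have := hnorm k
  rw [mul_one_div, le_div_iff₀ (by positivity)] at this
  push_cast at this
  linarith

end IsC0Semigroup

end Hilbert

end Semigroups

/-! ### A Phragmén–Lindelöf bound on the half-plane -/

section PhragmenLindelofBound

/-- A function on the right half-plane bounded by `C e ^ (k re w)` and of subexponential growth on
the positive real axis is bounded by `C`. -/
theorem norm_le_of_subexponential_on_real {F : ℂ → ℂ} {C k : ℝ}
    (hk : 0 ≤ k) (hd : ∀ w : ℂ, 0 < w.re → DifferentiableAt ℂ F w)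
    (hbound : ∀ w : ℂ, 0 < w.re → ‖F w‖ ≤ C * Real.exp (k * w.re))
    (hreal : ∀ η : ℝ, 0 < η →
      IsBoundedUnder (· ≤ ·) atTop fun x : ℝ => Real.exp (-(η * x)) * ‖F x‖)
    {w : ℂ} (hw : 0 < w.re) : ‖F w‖ ≤ C := by
  have hC : 0 ≤ C := by
    have := (norm_nonneg _).trans (hbound w hw)
    exact nonneg_of_mul_nonneg_left this (Real.exp_pos _)
  -- The shift by `η` moves the problem off the boundary, where `F` is uncontrolled; the factor
  -- `e^{-η z}` turns subexponential growth on the real axis into boundedness. On the imaginary axis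
  -- the bound is `C e^{k η}`, and `η → 0` at the end.
  have step : ∀ η : ℝ, 0 < η →
      ‖Complex.exp (-(η * w)) * F (w + η)‖ ≤ C * Real.exp (k * η) := by
    intro η hη
    set G : ℂ → ℂ := fun z => Complex.exp (-(η * z)) * F (z + η) with hG
    have hnorm : ∀ z : ℂ, ‖G z‖ = Real.exp (-(η * z.re)) * ‖F (z + η)‖ := by
      intro z
      simp [hG, Complex.norm_exp]
    have hGd : ∀ z : ℂ, 0 ≤ z.re → DifferentiableAt ℂ G z := by
      intro z hz
      have h1 : DifferentiableAt ℂ (fun z : ℂ => F (z + η)) z := by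
        refine DifferentiableAt.comp (g := F) z (hd _ ?_) (by fun_prop)
        simp; linarith
      exact DifferentiableAt.mul (by fun_prop) h1
    refine PhragmenLindelof.right_half_plane_of_bounded_on_real (f := G) ?_ ?_ ?_ ?_ hw.le
    · refine ⟨fun z hz => (hGd z (le_of_lt hz)).differentiableWithinAt, ?_⟩
      intro z hz
      rw [Complex.closure_setOfPred_lt_re] at hz
      exact (hGd z hz).continuousAt.continuousWithinAt
    · refine ⟨1, one_lt_two, k, Asymptotics.IsBigO.of_bound (C * Real.exp (k * η)) ?_⟩
      rw [eventually_inf_principal]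
      refine Eventually.of_forall fun z hz => ?_
      have hz' : 0 < z.re := hz
      rw [hnorm, Real.rpow_one, Real.norm_of_nonneg (Real.exp_pos _).le]
      have h1 := hbound (z + η) (by simp; linarith)
      have h2 : Real.exp (-(η * z.re)) ≤ 1 := Real.exp_le_one_iff.2 (by nlinarith)
      calc _ ≤ 1 * (C * Real.exp (k * (z + η).re)) := by gcongr
        _ = C * Real.exp (k * η) * Real.exp (k * z.re) := by
          rw [mul_assoc, ← Real.exp_add, one_mul]; congr 2; simp; ring
        _ ≤ _ := by gcongr; exact Complex.re_le_norm z
    · obtain ⟨b, hb⟩ := hreal η hη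
      refine ⟨Real.exp (η * η) * b, ?_⟩
      rw [eventually_map] at hb ⊢
      filter_upwards [(tendsto_atTop_add_const_right atTop η tendsto_id).eventually hb] with x hx
      rw [hnorm]
      simp only [id, Complex.ofReal_add, Complex.ofReal_re] at hx ⊢
      have : Real.exp (-(η * x)) = Real.exp (η * η) * Real.exp (-(η * (x + η))) := by
        rw [← Real.exp_add]; congr 1; ring
      rw [this, mul_assoc]
      gcongr
    · intro y
      rw [hnorm]
      have h1 := hbound (y * Complex.I + η) (by simpa using hη)
      simpa using h1
  have l1 : Tendsto (fun η : ℝ => ‖Complex.exp (-(η * w)) * F (w + η)‖) (𝓝[>] 0) (𝓝 ‖F w‖) := by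
    have hc : ContinuousAt (fun η : ℝ => ‖Complex.exp (-(η * w)) * F (w + η)‖) 0 := by
      have h1 : ContinuousAt (fun η : ℝ => F (w + η)) 0 := by
        refine ContinuousAt.comp (g := F) ?_ (by fun_prop)
        simpa using (hd w hw).continuousAt
      have h2 : ContinuousAt (fun η : ℝ => Complex.exp (-(η * w))) 0 := by fun_prop
      exact (h2.mul h1).norm
    simpa using hc.tendsto.mono_left nhdsWithin_le_nhds
  have l2 : Tendsto (fun η : ℝ => C * Real.exp (k * η)) (𝓝[>] 0) (𝓝 C) := by
    have hc : Continuous (fun η : ℝ => C * Real.exp (k * η)) := by fun_prop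
    simpa using (hc.tendsto 0).mono_left nhdsWithin_le_nhds
  refine le_of_tendsto_of_tendsto l1 l2 ?_
  filter_upwards [self_mem_nhdsWithin] with η hη
  exact step η hη

end PhragmenLindelofBound

/-! ### Multiplication operators on `L₂` -/

section Multiplication

variable {α : Type*} [MeasurableSpace α] {μ : Measure α}

/-- Multiplication by an essentially bounded function, as an operator on `L₂`. -/
def mulOp (m : α → ℂ) (hm : MemLp m ∞ μ) : Lp ℂ 2 μ →L[ℂ] Lp ℂ 2 μ :=
  (ContinuousLinearMap.mul ℂ ℂ).holderL μ ∞ 2 2 (hm.toLp m)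

lemma coeFn_mulOp (m : α → ℂ) (hm : MemLp m ∞ μ) (f : Lp ℂ 2 μ) :
    mulOp m hm f =ᵐ[μ] fun x => m x * f x := by
  filter_upwards [(ContinuousLinearMap.mul ℂ ℂ).coeFn_holder (r := 2) (hm.toLp m) f,
    hm.coeFn_toLp] with x h1 h2
  rw [mulOp, ContinuousLinearMap.holderL_apply_apply, h1, h2]
  rfl

lemma norm_mulOp_le {m : α → ℂ} (hm : MemLp m ∞ μ) {C : ℝ} (hC0 : 0 ≤ C)
    (hC : ∀ x, ‖m x‖ ≤ C) : ‖mulOp m hm‖ ≤ C := by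
  refine ContinuousLinearMap.opNorm_le_bound _ hC0 fun f => ?_
  refine Lp.norm_le_mul_norm_of_ae_le_mul ?_
  filter_upwards [coeFn_mulOp m hm f] with x hx
  rw [hx, norm_mul]
  gcongr
  exact hC x

lemma inner_mulOp_ofReal (m : α → ℝ) (hm : MemLp (fun x => (m x : ℂ)) ∞ μ) (f g : Lp ℂ 2 μ) :
    inner ℂ f (mulOp _ hm g) = inner ℂ (mulOp _ hm f) g := by
  rw [L2.inner_def, L2.inner_def]
  refine integral_congr_ae ?_
  filter_upwards [coeFn_mulOp _ hm f, coeFn_mulOp _ hm g] with x h1 h2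
  rw [h1, h2]
  simp
  ring

lemma mulOp_mulOp {m₁ m₂ m : α → ℂ} (h₁ : MemLp m₁ ∞ μ) (h₂ : MemLp m₂ ∞ μ) (h : MemLp m ∞ μ)
    (f : Lp ℂ 2 μ) (hm : ∀ x, f x ≠ 0 → m₁ x * m₂ x = m x) :
    mulOp m₁ h₁ (mulOp m₂ h₂ f) = mulOp m h f := by
  apply Lp.ext
  filter_upwards [coeFn_mulOp m₁ h₁ (mulOp m₂ h₂ f), coeFn_mulOp m₂ h₂ f, coeFn_mulOp m h f]
    with x e1 e2 e3
  rw [e1, e2, e3, ← mul_assoc]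
  by_cases hx : f x = 0
  · simp [hx]
  · rw [hm x hx]

lemma tendsto_mulOp {m : ℕ → α → ℂ} (hm : ∀ n, MemLp (m n) ∞ μ) (hm1 : ∀ n x, ‖m n x‖ ≤ 1)
    (hlim : ∀ x, ∀ᶠ n in atTop, m n x = 1) (f : Lp ℂ 2 μ) :
    Tendsto (fun n => mulOp (m n) (hm n) f) atTop (𝓝 f) := by
  rw [Lp.tendsto_Lp_iff_tendsto_eLpNorm']
  have e : ∀ n, eLpNorm (⇑(mulOp (m n) (hm n) f) - ⇑f) 2 μ
      = (∫⁻ x, ‖(m n x - 1) * f x‖ₑ ^ (2 : ℝ) ∂μ) ^ (1 / 2 : ℝ) := by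
    intro n
    rw [eLpNorm_eq_lintegral_rpow_enorm_toReal (by simp) (by simp)]
    simp only [ENNReal.toReal_ofNat]
    congr 1
    refine lintegral_congr_ae ?_
    filter_upwards [coeFn_mulOp (m n) (hm n) f] with x hx
    rw [Pi.sub_apply, hx, sub_mul, one_mul]
  simp only [e]
  have h2 : ∫⁻ x, ‖f x‖ₑ ^ (2 : ℝ) ∂μ < ∞ := by
    have := lintegral_rpow_enorm_lt_top_of_eLpNorm_lt_top (p := 2) (by simp) (by simp)
      (Lp.memLp f).2
    simpa using this
  have h3 : Tendsto (fun n => ∫⁻ x, ‖(m n x - 1) * f x‖ₑ ^ (2 : ℝ) ∂μ) atTop (𝓝 (∫⁻ _, 0 ∂μ)) := by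
    refine tendsto_lintegral_of_dominated_convergence' (fun x => 4 * ‖f x‖ₑ ^ (2 : ℝ)) ?_ ?_ ?_ ?_
    · intro n
      exact ((((hm n).1.sub aestronglyMeasurable_const).mul (Lp.memLp f).1).enorm).pow_const _
    · intro n
      refine Eventually.of_forall fun x => ?_
      have h1 : ‖m n x - 1‖ₑ ≤ 2 := by
        rw [← ofReal_norm]
        refine ENNReal.ofReal_le_of_le_toReal ?_
        refine (norm_sub_le _ _).trans ?_
        simp only [norm_one, ENNReal.toReal_ofNat]
        linarith [hm1 n x]
      dsimp only
      rw [enorm_mul, ENNReal.mul_rpow_of_nonneg _ _ zero_le_two]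
      gcongr
      calc ‖m n x - 1‖ₑ ^ (2 : ℝ) ≤ 2 ^ (2 : ℝ) := by gcongr
        _ = 4 := by norm_num [ENNReal.rpow_ofNat]
    · rw [lintegral_const_mul' _ _ (by simp)]
      exact ENNReal.mul_ne_top (by simp) h2.ne
    · refine Eventually.of_forall fun x => ?_
      refine tendsto_const_nhds.congr' ?_
      filter_upwards [hlim x] with n hn
      simp [hn]
  rw [lintegral_zero] at h3
  have := (ENNReal.continuous_rpow_const (y := 1 / 2)).tendsto 0 |>.comp h3
  simpa [Function.comp_def] using this

variable (μ) in
lemma memLp_exp_mul {q : α → ℝ} (hq : Measurable q) {K : ℝ} (hK : ∀ x, |q x| ≤ K) (w : ℂ) :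
    MemLp (fun x => Complex.exp (w * q x)) ∞ μ := by
  refine memLp_top_of_bound (by fun_prop) (Real.exp (‖w‖ * K)) (Eventually.of_forall fun x => ?_)
  refine (Complex.norm_exp_le_exp_norm _).trans (Real.exp_le_exp.2 ?_)
  rw [norm_mul, Complex.norm_real, Real.norm_eq_abs]
  gcongr
  exact hK x

variable (μ) in
/-- Multiplication by `e ^ (w q)`, for a bounded function `q`. -/
def expMulOp {q : α → ℝ} (hq : Measurable q) {K : ℝ} (hK : ∀ x, |q x| ≤ K) (w : ℂ) :
    Lp ℂ 2 μ →L[ℂ] Lp ℂ 2 μ :=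
  mulOp _ (memLp_exp_mul μ hq hK w)

/-- Boundedness of `q` makes the second-order remainder of `w ↦ e^{w q(x)}` uniform in `x`. This is
one reason for truncating the squared distance. -/
lemma differentiable_expMulOp {q : α → ℝ} (hq : Measurable q) {K : ℝ} (hK : ∀ x, |q x| ≤ K) :
    Differentiable ℂ (expMulOp μ hq hK) := by
  intro w
  have hm : MemLp (fun x => q x * Complex.exp (w * q x)) ∞ μ := by
    refine memLp_top_of_bound (by fun_prop) (K * Real.exp (‖w‖ * K))
      (Eventually.of_forall fun x => ?_)
    have hK0 := (abs_nonneg _).trans (hK x)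
    rw [norm_mul, Complex.norm_real, Real.norm_eq_abs]
    gcongr
    · exact hK x
    refine (Complex.norm_exp_le_exp_norm _).trans (Real.exp_le_exp.2 ?_)
    rw [norm_mul, Complex.norm_real, Real.norm_eq_abs]
    gcongr
    exact hK x
  suffices H : HasDerivAt (expMulOp μ hq hK) (mulOp _ hm) w from H.differentiableAt
  rw [hasDerivAt_iff_isLittleO_nhds_zero]
  have key : (fun h : ℂ => expMulOp μ hq hK (w + h) - expMulOp μ hq hK w - h • mulOp _ hm)
      =O[𝓝 0] fun h : ℂ => ‖h‖ ^ 2 := by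
    refine Asymptotics.IsBigO.of_bound (Real.exp (‖w‖ * K) * (K ^ 2 * Real.exp K)) ?_
    filter_upwards [Metric.closedBall_mem_nhds (0 : ℂ) one_pos] with h hh
    have hh' : ‖h‖ ≤ 1 := by simpa using hh
    refine ContinuousLinearMap.opNorm_le_bound _ (by positivity) fun f => ?_
    refine Lp.norm_le_mul_norm_of_ae_le_mul ?_
    simp only [sub_apply, smul_apply]
    filter_upwards [Lp.coeFn_sub (expMulOp μ hq hK (w + h) f - expMulOp μ hq hK w f)
        (h • mulOp _ hm f), Lp.coeFn_sub (expMulOp μ hq hK (w + h) f) (expMulOp μ hq hK w f),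
      Lp.coeFn_smul h (mulOp _ hm f), coeFn_mulOp _ hm f,
      coeFn_mulOp _ (memLp_exp_mul μ hq hK w) f,
      coeFn_mulOp _ (memLp_exp_mul μ hq hK (w + h)) f] with x e1 e2 e3 e4 e5 e6
    have hK0 := (abs_nonneg _).trans (hK x)
    rw [e1, Pi.sub_apply, e2, e3, Pi.sub_apply, Pi.smul_apply, e4]
    rw [expMulOp, expMulOp, e5, e6]
    have e : Complex.exp ((w + h) * q x) * f x - Complex.exp (w * q x) * f x
          - h • (q x * Complex.exp (w * q x) * f x)
        = Complex.exp (w * q x) * (Complex.exp (h * q x)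
          - ∑ m ∈ Finset.range 2, (h * q x) ^ m / m.factorial) * f x := by
      rw [add_mul, Complex.exp_add]
      simp [Finset.sum_range_succ]
      ring
    rw [e, norm_mul, norm_mul, norm_pow, norm_norm]
    have b1 : ‖Complex.exp (w * q x)‖ ≤ Real.exp (‖w‖ * K) := by
      refine (Complex.norm_exp_le_exp_norm _).trans (Real.exp_le_exp.2 ?_)
      rw [norm_mul, Complex.norm_real, Real.norm_eq_abs]
      gcongr
      exact hK x
    have b2 := Complex.norm_exp_sub_sum_le_norm_mul_exp (h * q x) 2
    have b3 : ‖h * (q x : ℂ)‖ ≤ ‖h‖ * K := by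
      rw [norm_mul, Complex.norm_real, Real.norm_eq_abs]
      gcongr
      exact hK x
    have b4 : ‖h * (q x : ℂ)‖ ≤ K := b3.trans (mul_le_of_le_one_left hK0 hh')
    rw [mul_assoc (Real.exp _)]
    gcongr
    calc _ ≤ (‖h‖ * K) ^ 2 * Real.exp K := by
          refine b2.trans ?_
          gcongr
      _ = _ := by ring
  refine key.trans_isLittleO ?_
  simpa using (Asymptotics.isLittleO_norm_pow_id (E' := ℂ) one_lt_two)

end Multiplication

/-! ### Gaussian weights against the Gaussian kernel -/

section KernelBounds

variable {d : ℕ} {Ω : Set (EuclideanSpace ℝ (Fin d))}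

theorem HasIntegralKernel.norm_inner_le {B : L2 Ω →L[ℂ] L2 Ω}
    {p : EuclideanSpace ℝ (Fin d) × EuclideanSpace ℝ (Fin d) → ℂ} (hB : HasIntegralKernel B p)
    {u v : L2 Ω} {φ ψ : EuclideanSpace ℝ (Fin d) → ℝ}
    (hφ : Integrable φ (volume.restrict Ω)) (hψ : Integrable ψ (volume.restrict Ω))
    (h : ∀ᵐ z ∂((volume.restrict Ω).prod (volume.restrict Ω)),
      ‖v z.1‖ * (‖p z‖ * ‖u z.2‖) ≤ φ z.1 * ψ z.2) :
    ‖inner ℂ v (B u)‖ ≤ (∫ x in Ω, φ x) * ∫ y in Ω, ψ y := by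
  rw [L2.inner_def, ← integral_mul_const]
  refine norm_integral_le_of_norm_le (hφ.mul_const _) ?_
  filter_upwards [hB.2 u, Measure.ae_ae_of_ae_prod h] with x hx hx2
  refine (norm_inner_le_norm _ _).trans ?_
  rw [hx.2]
  calc ‖v x‖ * ‖∫ y in Ω, p (x, y) * u y‖ ≤ ‖v x‖ * ∫ y in Ω, ‖p (x, y) * u y‖ := by
        gcongr; exact norm_integral_le_integral_norm _
    _ = ∫ y in Ω, ‖v x‖ * ‖p (x, y) * u y‖ := (integral_const_mul _ _).symm
    _ ≤ ∫ y in Ω, φ x * ψ y := by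
        refine integral_mono_ae (hx.1.norm.const_mul _) (hψ.const_mul _) ?_
        filter_upwards [hx2] with y hy
        simpa only [norm_mul] using hy
    _ = _ := integral_const_mul _ _

lemma inner_expMulOp_ofReal {α : Type*} [MeasurableSpace α] {μ : Measure α} {q : α → ℝ}
    (hq : Measurable q) {K : ℝ} (hK : ∀ x, |q x| ≤ K) (t : ℝ) (f g : Lp ℂ 2 μ) :
    inner ℂ f (expMulOp μ hq hK t g) = inner ℂ (expMulOp μ hq hK t f) g := by
  rw [L2.inner_def, L2.inner_def]
  refine integral_congr_ae ?_
  filter_upwards [coeFn_mulOp _ (memLp_exp_mul μ hq hK t) f,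
    coeFn_mulOp _ (memLp_exp_mul μ hq hK t) g] with x h1 h2
  rw [expMulOp, h1, h2]
  simp [← Complex.exp_conj]
  ring

/-- Cauchy–Schwarz in the form `(u + v)² ≤ (a + b)(u²/a + v²/b)`. It dictates the pair of weights
`1/(2κ)` and `1/(2κ + a)`. -/
lemma sq_div_add_le_add_div {u v w a b : ℝ} (ha : 0 < a) (hb : 0 < b) (hw : 0 ≤ w)
    (h : w ≤ u + v) : w ^ 2 / (b + a) ≤ u ^ 2 / a + v ^ 2 / b := by
  have h1 : w ^ 2 ≤ (u + v) ^ 2 := by gcongr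
  have h2 : (u + v) ^ 2 / (b + a) ≤ u ^ 2 / a + v ^ 2 / b := by
    rw [div_add_div _ _ ha.ne' hb.ne', div_le_div_iff₀ (by positivity) (by positivity)]
    nlinarith [sq_nonneg (b * u - a * v)]
  exact (by gcongr : w ^ 2 / (b + a) ≤ (u + v) ^ 2 / (b + a)).trans h2

lemma norm_exp_neg_mul_norm_sq_le {c : ℝ} (hc : 0 ≤ c) (x₀ x : EuclideanSpace ℝ (Fin d)) :
    ‖((Real.exp (-(c * ‖x - x₀‖ ^ 2)) : ℝ) : ℂ)‖ ≤ 1 := by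
  rw [Complex.norm_real, Real.norm_of_nonneg (Real.exp_pos _).le, Real.exp_le_one_iff]
  have : 0 ≤ c * ‖x - x₀‖ ^ 2 := by positivity
  linarith

variable (Ω) in
lemma memLp_gaussian {c : ℝ} (hc : 0 ≤ c) (x₀ : EuclideanSpace ℝ (Fin d)) :
    MemLp (fun x => ((Real.exp (-(c * ‖x - x₀‖ ^ 2)) : ℝ) : ℂ)) ∞ (volume.restrict Ω) :=
  memLp_top_of_bound (by fun_prop) 1
    (Eventually.of_forall fun x => norm_exp_neg_mul_norm_sq_le hc x₀ x)

variable (Ω) in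
/-- Multiplication by the Gaussian `e ^ (-c |x - x₀|²)`. -/
def gaussianOp {c : ℝ} (hc : 0 ≤ c) (x₀ : EuclideanSpace ℝ (Fin d)) : L2 Ω →L[ℂ] L2 Ω :=
  mulOp _ (memLp_gaussian Ω hc x₀)

variable (Ω) in
lemma memLp_indicator_ball (x₀ : EuclideanSpace ℝ (Fin d)) (R : ℝ) :
    MemLp (fun x => (((Metric.ball x₀ R).indicator 1 x : ℝ) : ℂ)) ∞ (volume.restrict Ω) := by
  refine memLp_top_of_bound ?_ 1 (Eventually.of_forall fun x => ?_)
  · exact (Complex.measurable_ofReal.comp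
      (measurable_one.indicator measurableSet_ball)).aestronglyMeasurable
  · by_cases hx : x ∈ Metric.ball x₀ R <;> simp [Set.indicator, hx]

variable (Ω) in
/-- Multiplication by the indicator function of a ball. -/
def ballOp (x₀ : EuclideanSpace ℝ (Fin d)) (R : ℝ) : L2 Ω →L[ℂ] L2 Ω :=
  mulOp _ (memLp_indicator_ball Ω x₀ R)

lemma norm_indicator_ball_le (x₀ x : EuclideanSpace ℝ (Fin d)) (R : ℝ) :
    ‖(((Metric.ball x₀ R).indicator 1 x : ℝ) : ℂ)‖ ≤ 1 := by
  by_cases hx : x ∈ Metric.ball x₀ R <;> simp [Set.indicator, hx]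

lemma norm_ballOp_le (x₀ : EuclideanSpace ℝ (Fin d)) (R : ℝ) : ‖ballOp Ω x₀ R‖ ≤ 1 :=
  norm_mulOp_le _ zero_le_one fun x => norm_indicator_ball_le x₀ x R

lemma ballOp_eq_zero (x₀ : EuclideanSpace ℝ (Fin d)) (R : ℝ) (f : L2 Ω) :
    ∀ᵐ x ∂(volume.restrict Ω), x ∉ Metric.ball x₀ R → ballOp Ω x₀ R f x = 0 := by
  filter_upwards [coeFn_mulOp _ (memLp_indicator_ball Ω x₀ R) f] with x hx hxR
  rw [ballOp, hx]
  simp [hxR]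

lemma tendsto_ballOp (x₀ : EuclideanSpace ℝ (Fin d)) (f : L2 Ω) :
    Tendsto (fun n : ℕ => ballOp Ω x₀ n f) atTop (𝓝 f) := by
  refine tendsto_mulOp (fun n : ℕ => memLp_indicator_ball Ω x₀ n)
    (fun n x => norm_indicator_ball_le x₀ x n) (fun x => ?_) f
  obtain ⟨n, hn⟩ := exists_nat_gt (dist x x₀)
  filter_upwards [eventually_ge_atTop n] with m hm
  have : x ∈ Metric.ball x₀ (m : ℝ) := hn.trans_le (by exact_mod_cast hm)
  rw [Set.indicator_of_mem this]
  simp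

lemma integrable_of_eq_zero_off_ball {x₀ : EuclideanSpace ℝ (Fin d)} {R : ℝ} {f : L2 Ω}
    (hf : ∀ᵐ x ∂(volume.restrict Ω), x ∉ Metric.ball x₀ R → f x = 0) :
    Integrable f (volume.restrict Ω) := by
  have h1 : IntegrableOn f (Metric.ball x₀ R) (volume.restrict Ω) := by
    have : IsFiniteMeasure ((volume.restrict Ω).restrict (Metric.ball x₀ R)) := by
      refine ⟨?_⟩
      rw [Measure.restrict_apply_univ]
      exact (Measure.restrict_le_self _).trans_lt measure_ball_lt_top
    exact ((Lp.memLp f).restrict _).integrable (by norm_num)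
  rw [← integrable_indicator_iff measurableSet_ball] at h1
  refine h1.congr ?_
  filter_upwards [hf] with x hx
  by_cases h : x ∈ Metric.ball x₀ R
  · simp [h]
  · simp [h, hx h]

variable (d) in
/-- The squared distance to `x₀`, cut off outside a ball. -/
def truncSq (x₀ : EuclideanSpace ℝ (Fin d)) (R : ℝ) : EuclideanSpace ℝ (Fin d) → ℝ :=
  (Metric.ball x₀ R).indicator fun x => ‖x - x₀‖ ^ 2

lemma measurable_truncSq (x₀ : EuclideanSpace ℝ (Fin d)) (R : ℝ) : Measurable (truncSq d x₀ R) :=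
  Measurable.indicator (by fun_prop) measurableSet_ball

lemma truncSq_nonneg (x₀ x : EuclideanSpace ℝ (Fin d)) (R : ℝ) : 0 ≤ truncSq d x₀ R x :=
  Set.indicator_nonneg (fun _ _ => by positivity) _

lemma truncSq_of_mem {x₀ x : EuclideanSpace ℝ (Fin d)} {R : ℝ} (hx : x ∈ Metric.ball x₀ R) :
    truncSq d x₀ R x = ‖x - x₀‖ ^ 2 := Set.indicator_of_mem hx _

lemma abs_truncSq_le (x₀ : EuclideanSpace ℝ (Fin d)) (R : ℝ) (x : EuclideanSpace ℝ (Fin d)) :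
    |truncSq d x₀ R x| ≤ R ^ 2 := by
  rw [abs_of_nonneg (truncSq_nonneg x₀ x R)]
  by_cases hx : x ∈ Metric.ball x₀ R
  · rw [truncSq_of_mem hx]
    rw [mem_ball_iff_norm] at hx
    gcongr
  · rw [truncSq, Set.indicator_of_notMem hx]
    positivity

variable {T : ℝ → L2 Ω →L[ℂ] L2 Ω} {M ω a : ℝ}

/-- Multiplication by `e ^ (w q)`, where `q` is the squared distance to `x₀`, cut off outside a
ball. -/
def expSqOp (Ω : Set (EuclideanSpace ℝ (Fin d))) (x₀ : EuclideanSpace ℝ (Fin d)) (R : ℝ) (w : ℂ) :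
    L2 Ω →L[ℂ] L2 Ω :=
  expMulOp (volume.restrict Ω) (measurable_truncSq x₀ R) (abs_truncSq_le x₀ R) w

lemma norm_expSqOp_le (x₀ : EuclideanSpace ℝ (Fin d)) (R : ℝ) {w : ℂ} (hw : 0 ≤ w.re) :
    ‖expSqOp Ω x₀ R w‖ ≤ Real.exp (w.re * R ^ 2) := by
  refine norm_mulOp_le _ (Real.exp_pos _).le fun x => ?_
  rw [Complex.norm_exp, Complex.re_mul_ofReal]
  gcongr
  exact (le_abs_self _).trans (abs_truncSq_le x₀ R x)

lemma norm_expSqOp_le_one (x₀ : EuclideanSpace ℝ (Fin d)) (R : ℝ) {w : ℂ} (hw : w.re ≤ 0) :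
    ‖expSqOp Ω x₀ R w‖ ≤ 1 := by
  refine norm_mulOp_le _ zero_le_one fun x => ?_
  rw [Complex.norm_exp, Complex.re_mul_ofReal, Real.exp_le_one_iff]
  exact mul_nonpos_of_nonpos_of_nonneg hw (truncSq_nonneg x₀ x R)

lemma coeFn_expSqOp (x₀ : EuclideanSpace ℝ (Fin d)) (R t : ℝ) (f : L2 Ω) :
    ∀ᵐ x ∂(volume.restrict Ω), ‖expSqOp Ω x₀ R t f x‖ = Real.exp (t * truncSq d x₀ R x) * ‖f x‖ := by
  filter_upwards [coeFn_mulOp _ (memLp_exp_mul (volume.restrict Ω) (measurable_truncSq x₀ R)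
    (abs_truncSq_le x₀ R) t) f] with x hx
  rw [expSqOp, expMulOp, hx, norm_mul, Complex.norm_exp, Complex.re_mul_ofReal, Complex.ofReal_re]

/-- For real parameters the Gaussian weights absorb the exponential factor of the kernel. -/
lemma norm_inner_expSqOp_le (ha : 0 < a) (hgauss : HasGaussianUpperBounds T M ω a)
    {κ : ℝ} (hκ : 0 < κ) (x₀ : EuclideanSpace ℝ (Fin d)) (R : ℝ) {f g : L2 Ω}
    (hf : ∀ᵐ x ∂(volume.restrict Ω), x ∉ Metric.ball x₀ R → f x = 0)
    (hg : ∀ᵐ x ∂(volume.restrict Ω), x ∉ Metric.ball x₀ R → g x = 0) {x : ℝ} (hx : 0 < x)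
    (hM : 0 ≤ M) :
    ‖inner ℂ g (expSqOp Ω x₀ R ((-(1 / (2 * κ)) * x : ℝ) : ℂ)
        (T x⁻¹ (expSqOp Ω x₀ R ((1 / (2 * κ + a) * x : ℝ) : ℂ) f)))‖
      ≤ M * Real.exp (ω * x⁻¹) * (a * Real.pi * x⁻¹) ^ (-(d : ℝ) / 2)
        * (∫ y in Ω, ‖g y‖) * ∫ y in Ω, ‖f y‖ := by
  obtain ⟨p, hp, hbound⟩ := hgauss x⁻¹ (inv_pos.2 hx)
  set K := M * Real.exp (ω * x⁻¹) * (a * Real.pi * x⁻¹) ^ (-(d : ℝ) / 2) with hK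
  have hK0 : 0 ≤ K := by positivity
  have eK : K * ∫ y in Ω, ‖g y‖ = ∫ y in Ω, K * ‖g y‖ := (integral_const_mul _ _).symm
  rw [expSqOp, inner_expMulOp_ofReal, ← expSqOp, eK]
  refine hp.norm_inner_le ((integrable_of_eq_zero_off_ball hg).norm.const_mul K)
    (integrable_of_eq_zero_off_ball hf).norm ?_
  filter_upwards [hbound, Measure.quasiMeasurePreserving_fst.ae hg,
    Measure.quasiMeasurePreserving_snd.ae hf,
    Measure.quasiMeasurePreserving_fst.ae (coeFn_expSqOp x₀ R (-(1 / (2 * κ)) * x) g),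
    Measure.quasiMeasurePreserving_snd.ae (coeFn_expSqOp x₀ R (1 / (2 * κ + a) * x) f)]
    with z h1 h2 h3 h4 h5
  rw [h4, h5]
  by_cases hz1 : z.1 ∈ Metric.ball x₀ R
  swap
  · simp [h2 hz1]
  by_cases hz2 : z.2 ∈ Metric.ball x₀ R
  swap
  · simp [h3 hz2]
  rw [truncSq_of_mem hz1, truncSq_of_mem hz2]
  have hexp : Real.exp (-(1 / (2 * κ)) * x * ‖z.1 - x₀‖ ^ 2)
      * Real.exp (-(‖z.1 - z.2‖ ^ 2 / (a * x⁻¹)))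
      * Real.exp (1 / (2 * κ + a) * x * ‖z.2 - x₀‖ ^ 2) ≤ 1 := by
    rw [← Real.exp_add, ← Real.exp_add, Real.exp_le_one_iff]
    have h6 := sq_div_add_le_add_div (u := ‖z.1 - z.2‖) (v := ‖z.1 - x₀‖) (w := ‖z.2 - x₀‖) ha
      (show 0 < 2 * κ by positivity) (norm_nonneg _) (by
        rw [norm_sub_rev z.1 z.2]; exact norm_sub_le_norm_sub_add_norm_sub _ _ _)
    have h7 := mul_le_mul_of_nonneg_left h6 hx.le
    have e1 : -(1 / (2 * κ)) * x * ‖z.1 - x₀‖ ^ 2 = -(x * (‖z.1 - x₀‖ ^ 2 / (2 * κ))) := by ring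
    have e2 : -(‖z.1 - z.2‖ ^ 2 / (a * x⁻¹)) = -(x * (‖z.1 - z.2‖ ^ 2 / a)) := by field_simp
    have e3 : 1 / (2 * κ + a) * x * ‖z.2 - x₀‖ ^ 2 = x * (‖z.2 - x₀‖ ^ 2 / (2 * κ + a)) := by ring
    rw [e1, e2, e3]
    linarith
  calc _ ≤ Real.exp (-(1 / (2 * κ)) * x * ‖z.1 - x₀‖ ^ 2) * ‖g z.1‖
        * (K * Real.exp (-(‖z.1 - z.2‖ ^ 2 / (a * x⁻¹)))
          * (Real.exp (1 / (2 * κ + a) * x * ‖z.2 - x₀‖ ^ 2) * ‖f z.2‖)) := by gcongr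
    _ = (Real.exp (-(1 / (2 * κ)) * x * ‖z.1 - x₀‖ ^ 2)
      * Real.exp (-(‖z.1 - z.2‖ ^ 2 / (a * x⁻¹)))
      * Real.exp (1 / (2 * κ + a) * x * ‖z.2 - x₀‖ ^ 2)) * (K * ‖g z.1‖ * ‖f z.2‖) := by ring
    _ ≤ 1 * (K * ‖g z.1‖ * ‖f z.2‖) := by gcongr
    _ = _ := by rw [one_mul]

end KernelBounds

/-! ### Weighted `L₂` estimates with the sharp exponential rate -/

section WeightedBounds

variable {d : ℕ} {Ω : Set (EuclideanSpace ℝ (Fin d))} {T : ℝ → L2 Ω →L[ℂ] L2 Ω} {M ω a E : ℝ}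

theorem norm_inner_expSqOp_le_exp (hT : IsC0Semigroup T) (hpos : ∀ t, 0 ≤ t → 0 ≤ T t)
    (h1 : ‖T 1‖ ≤ Real.exp (-E)) (hM : 0 ≤ M) (ha : 0 < a)
    (hgauss : HasGaussianUpperBounds T M ω a) {κ : ℝ} (hκ : 0 < κ)
    (x₀ : EuclideanSpace ℝ (Fin d)) (R : ℝ) {f g : L2 Ω}
    (hf : ∀ᵐ x ∂(volume.restrict Ω), x ∉ Metric.ball x₀ R → f x = 0)
    (hg : ∀ᵐ x ∂(volume.restrict Ω), x ∉ Metric.ball x₀ R → g x = 0) {s : ℝ} (hs : 0 < s) :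
    ‖inner ℂ g (expSqOp Ω x₀ R ((-(1 / (2 * κ)) * s⁻¹ : ℝ) : ℂ)
        (T s (expSqOp Ω x₀ R ((1 / (2 * κ + a) * s⁻¹ : ℝ) : ℂ) f)))‖
      ≤ Real.exp (-(E * s)) * (‖g‖ * ‖f‖) := by
  obtain ⟨A, hA, hA1, hTA⟩ := hT.exists_eq_exp_smul_opPow hpos h1
  set c₁ : ℝ := 1 / (2 * κ + a) with hc₁
  set c₂ : ℝ := 1 / (2 * κ) with hc₂
  have hc₁0 : 0 < c₁ := by positivity
  have hc₂0 : 0 < c₂ := by positivity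
  -- The variable `w` replaces `1/s`, so that the weights depend on it exponentially, and `A^{1/w}`
  -- remains a contraction because inversion preserves the half-plane.
  set F : ℂ → ℂ := fun w => inner ℂ g (expSqOp Ω x₀ R ((-c₂ : ℝ) * w)
    (opPow A w⁻¹ (expSqOp Ω x₀ R ((c₁ : ℝ) * w) f))) with hF
  have hre : ∀ w : ℂ, 0 < w.re → 0 < (w⁻¹).re := by
    intro w hw
    rw [Complex.inv_re]
    have : w ≠ 0 := by rintro rfl; simp at hw
    exact div_pos hw (Complex.normSq_pos.2 this)
  have hFT : ∀ x : ℝ, 0 < x → ‖F x‖ = Real.exp (E * x⁻¹) *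
      ‖inner ℂ g (expSqOp Ω x₀ R ((-c₂ * x : ℝ) : ℂ)
        (T x⁻¹ (expSqOp Ω x₀ R ((c₁ * x : ℝ) : ℂ) f)))‖ := by
    intro x hx
    rw [hTA _ (inv_pos.2 hx), smul_apply, map_smul, inner_smul_right, norm_mul,
      Complex.norm_real, Real.norm_of_nonneg (Real.exp_pos _).le, ← mul_assoc, ← Real.exp_add,
      add_neg_cancel, Real.exp_zero, one_mul, hF]
    simp only [Complex.ofReal_mul, Complex.ofReal_inv]
  have hd : ∀ w : ℂ, 0 < w.re → DifferentiableAt ℂ F w := by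
    intro w hw
    have hw0 : w ≠ 0 := by rintro rfl; simp at hw
    have hE : Differentiable ℂ (expSqOp Ω x₀ R) :=
      differentiable_expMulOp (measurable_truncSq x₀ R) (abs_truncSq_le x₀ R)
    have d1 : DifferentiableAt ℂ (fun w : ℂ => expSqOp Ω x₀ R ((-c₂ : ℝ) * w)) w :=
      (hE _).comp w (by fun_prop)
    have d2 : DifferentiableAt ℂ (fun w : ℂ => expSqOp Ω x₀ R ((c₁ : ℝ) * w)) w :=
      (hE _).comp w (by fun_prop)
    have d3 : DifferentiableAt ℂ (fun w : ℂ => opPow A w⁻¹) w :=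
      (hasDerivAt_opPow hA hA1 (hre w hw)).differentiableAt.comp w (differentiableAt_inv hw0)
    have d4 := d1.clm_apply (d3.clm_apply (d2.clm_apply (differentiableAt_const f)))
    exact (innerSL ℂ g).differentiableAt.comp w d4
  have hbound : ∀ w : ℂ, 0 < w.re → ‖F w‖ ≤ ‖g‖ * ‖f‖ * Real.exp (c₁ * R ^ 2 * w.re) := by
    intro w hw
    have b1 : ‖expSqOp Ω x₀ R ((-c₂ : ℝ) * w)‖ ≤ 1 := by
      refine norm_expSqOp_le_one x₀ R ?_
      rw [Complex.re_ofReal_mul]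
      nlinarith
    have b2 : ‖expSqOp Ω x₀ R ((c₁ : ℝ) * w)‖ ≤ Real.exp (c₁ * R ^ 2 * w.re) := by
      refine (norm_expSqOp_le x₀ R ?_).trans (le_of_eq ?_)
      · rw [Complex.re_ofReal_mul]; positivity
      · rw [Complex.re_ofReal_mul]; ring_nf
    have b3 := norm_opPow_le_one hA hA1 (hre w hw)
    calc ‖F w‖ ≤ ‖g‖ * ‖expSqOp Ω x₀ R ((-c₂ : ℝ) * w)
          (opPow A w⁻¹ (expSqOp Ω x₀ R ((c₁ : ℝ) * w) f))‖ := norm_inner_le_norm _ _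
      _ ≤ ‖g‖ * (1 * (1 * (Real.exp (c₁ * R ^ 2 * w.re) * ‖f‖))) := by
        gcongr
        refine ContinuousLinearMap.le_of_opNorm_le_of_le _ b1 ?_
        refine ContinuousLinearMap.le_of_opNorm_le_of_le _ b3 ?_
        exact ContinuousLinearMap.le_of_opNorm_le _ b2 _
      _ = _ := by ring
  have hreal : ∀ η : ℝ, 0 < η →
      IsBoundedUnder (· ≤ ·) atTop fun x : ℝ => Real.exp (-(η * x)) * ‖F x‖ := by
    intro η hη
    -- Large `x` means short time `1/x`: the kernel bound then contributes only `x^{d/2}`, which any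
    -- `e^{-η x}` beats.
    set C := M * (∫ y in Ω, ‖g y‖) * (∫ y in Ω, ‖f y‖) * (a * Real.pi) ^ (-(d : ℝ) / 2) with hC
    have l1 : Tendsto (fun x : ℝ => Real.exp ((E + ω) * x⁻¹)) atTop (𝓝 1) := by
      have : Continuous fun y : ℝ => Real.exp ((E + ω) * y) := by fun_prop
      simpa [Function.comp_def] using (this.tendsto 0).comp tendsto_inv_atTop_zero
    have l2 := tendsto_rpow_mul_exp_neg_mul_atTop_nhds_zero ((d : ℝ) / 2) η hη
    refine ((l1.mul l2).const_mul C).isBoundedUnder_le.mono_le ?_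
    filter_upwards [eventually_gt_atTop 0] with x hx
    have h3 := norm_inner_expSqOp_le ha hgauss hκ x₀ R hf hg hx hM
    have e1 : (a * Real.pi * x⁻¹) ^ (-(d : ℝ) / 2)
        = (a * Real.pi) ^ (-(d : ℝ) / 2) * x ^ ((d : ℝ) / 2) := by
      rw [Real.mul_rpow (by positivity) (by positivity), Real.inv_rpow hx.le,
        ← Real.rpow_neg hx.le]
      congr 2; ring
    rw [hFT x hx]
    calc _ ≤ Real.exp (-(η * x)) * (Real.exp (E * x⁻¹) *
          (M * Real.exp (ω * x⁻¹) * (a * Real.pi * x⁻¹) ^ (-(d : ℝ) / 2)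
            * (∫ y in Ω, ‖g y‖) * ∫ y in Ω, ‖f y‖)) := by gcongr
      _ = _ := by
        rw [e1, hC, add_mul, Real.exp_add, neg_mul]; ring
  have hs' : 0 < s⁻¹ := inv_pos.2 hs
  have key := norm_le_of_subexponential_on_real (by positivity) hd hbound hreal
    (w := (s⁻¹ : ℝ)) (by simpa using hs)
  rw [hFT _ hs', inv_inv] at key
  calc _ = Real.exp (-(E * s)) * (Real.exp (E * s) * _) := by
        rw [← mul_assoc, ← Real.exp_add, neg_add_cancel, Real.exp_zero, one_mul]
    _ ≤ _ := by gcongr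

lemma ballOp_expSqOp {c : ℝ} (hc : 0 ≤ c) (x₀ : EuclideanSpace ℝ (Fin d)) (R : ℝ) (f : L2 Ω) :
    ballOp Ω x₀ R (expSqOp Ω x₀ R ((-c : ℝ) : ℂ) f) = ballOp Ω x₀ R (gaussianOp Ω hc x₀ f) := by
  apply Lp.ext
  filter_upwards [coeFn_mulOp _ (memLp_indicator_ball Ω x₀ R) (expSqOp Ω x₀ R ((-c : ℝ) : ℂ) f),
    coeFn_mulOp _ (memLp_indicator_ball Ω x₀ R) (gaussianOp Ω hc x₀ f),
    coeFn_mulOp _ (memLp_gaussian Ω hc x₀) f,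
    coeFn_mulOp _ (memLp_exp_mul (volume.restrict Ω) (measurable_truncSq x₀ R)
      (abs_truncSq_le x₀ R) ((-c : ℝ) : ℂ)) f] with x e1 e2 e3 e4
  rw [ballOp, e1, e2, gaussianOp, e3, expSqOp, expMulOp, e4]
  by_cases hx : x ∈ Metric.ball x₀ R
  · rw [truncSq_of_mem hx]
    simp
  · simp [hx]

lemma expSqOp_ballOp {c : ℝ} (hc : 0 ≤ c) (x₀ : EuclideanSpace ℝ (Fin d)) (R : ℝ) (f : L2 Ω) :
    expSqOp Ω x₀ R (c : ℂ) (ballOp Ω x₀ R (gaussianOp Ω hc x₀ f)) = ballOp Ω x₀ R f := by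
  apply Lp.ext
  filter_upwards [coeFn_mulOp _ (memLp_exp_mul (volume.restrict Ω) (measurable_truncSq x₀ R)
      (abs_truncSq_le x₀ R) (c : ℂ)) (ballOp Ω x₀ R (gaussianOp Ω hc x₀ f)),
    coeFn_mulOp _ (memLp_indicator_ball Ω x₀ R) (gaussianOp Ω hc x₀ f),
    coeFn_mulOp _ (memLp_gaussian Ω hc x₀) f,
    coeFn_mulOp _ (memLp_indicator_ball Ω x₀ R) f] with x e1 e2 e3 e4
  rw [expSqOp, expMulOp, e1, ballOp, e2, e4, gaussianOp, e3]
  by_cases hx : x ∈ Metric.ball x₀ R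
  · rw [truncSq_of_mem hx]
    rw [Set.indicator_of_mem hx, Pi.one_apply, Complex.ofReal_one, one_mul, one_mul, ← mul_assoc,
      Complex.ofReal_exp, ← Complex.exp_add]
    simp
  · simp [hx]

lemma inner_ballOp_self (x₀ : EuclideanSpace ℝ (Fin d)) (R : ℝ) (v : L2 Ω) :
    inner ℂ (ballOp Ω x₀ R v) v = (‖ballOp Ω x₀ R v‖ : ℂ) ^ 2 := by
  have e : ballOp Ω x₀ R (ballOp Ω x₀ R v) = ballOp Ω x₀ R v := by
    refine mulOp_mulOp _ _ _ v fun x _ => ?_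
    by_cases hx : x ∈ Metric.ball x₀ R <;> simp [hx]
  have h1 := inner_self_eq_norm_sq_to_K (𝕜 := ℂ) (ballOp Ω x₀ R v)
  have h2 : inner ℂ (ballOp Ω x₀ R v) (ballOp Ω x₀ R v)
      = inner ℂ (ballOp Ω x₀ R (ballOp Ω x₀ R v)) v := inner_mulOp_ofReal _ _ _ _
  rw [e] at h2
  rw [← h2, h1]
  rfl

lemma norm_ballOp_apply_le (x₀ : EuclideanSpace ℝ (Fin d)) (R : ℝ) (f : L2 Ω) :
    ‖ballOp Ω x₀ R f‖ ≤ ‖f‖ :=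
  ((ballOp Ω x₀ R).le_of_opNorm_le (norm_ballOp_le x₀ R) f).trans_eq (one_mul _)

lemma tendsto_ballOp_apply (x₀ : EuclideanSpace ℝ (Fin d)) {u : ℕ → L2 Ω} {v : L2 Ω}
    (hu : Tendsto u atTop (𝓝 v)) : Tendsto (fun n : ℕ => ballOp Ω x₀ n (u n)) atTop (𝓝 v) := by
  have h : Tendsto (fun n : ℕ => ballOp Ω x₀ n (u n - v)) atTop (𝓝 0) :=
    squeeze_zero_norm (fun n => norm_ballOp_apply_le x₀ n _) (tendsto_iff_norm_sub_tendsto_zero.1 hu)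
  simpa using h.add (tendsto_ballOp x₀ v)

/-- The semigroup maps `L₂` with weight `e ^ (-|x - x₀|² / ((κ + a / 2) s))` to `L₂` with weight
`e ^ (-|x - x₀|² / (κ s))`, with norm at most `e ^ (-E s)`. -/
theorem norm_gaussianOp_apply_le (hT : IsC0Semigroup T) (hpos : ∀ t, 0 ≤ t → 0 ≤ T t)
    (h1 : ‖T 1‖ ≤ Real.exp (-E)) (hM : 0 ≤ M) (ha : 0 < a)
    (hgauss : HasGaussianUpperBounds T M ω a) {κ : ℝ} (hκ : 0 < κ)
    (x₀ : EuclideanSpace ℝ (Fin d)) {s : ℝ} (hs : 0 < s) {c₁ c₂ : ℝ} (hc₁ : 0 ≤ c₁) (hc₂ : 0 ≤ c₂)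
    (e₁ : c₁ = 1 / (2 * κ + a) * s⁻¹) (e₂ : c₂ = 1 / (2 * κ) * s⁻¹) (h : L2 Ω) :
    ‖gaussianOp Ω hc₂ x₀ (T s h)‖ ≤ Real.exp (-(E * s)) * ‖gaussianOp Ω hc₁ x₀ h‖ := by
  have key : ∀ n : ℕ, ‖ballOp Ω x₀ n (gaussianOp Ω hc₂ x₀ (T s (ballOp Ω x₀ n h)))‖
      ≤ Real.exp (-(E * s)) * ‖gaussianOp Ω hc₁ x₀ h‖ := by
    intro n
    set f := ballOp Ω x₀ n (gaussianOp Ω hc₁ x₀ h) with hf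
    set v := expSqOp Ω x₀ n ((-c₂ : ℝ) : ℂ) (T s (ballOp Ω x₀ n h)) with hv
    -- The growing weight cancels the Gaussian in `f`, leaving the truncated `h`; testing with the
    -- truncation of `v` itself gives a squared norm on the left, and one factor is divided out
    -- below.
    have h2 := norm_inner_expSqOp_le_exp hT hpos h1 hM ha hgauss hκ x₀ n (f := f)
      (g := ballOp Ω x₀ n v) (ballOp_eq_zero x₀ n _) (ballOp_eq_zero x₀ n _) hs
    rw [neg_mul, ← e₁, ← e₂, hf, expSqOp_ballOp, ← hv, inner_ballOp_self, norm_pow,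
      Complex.norm_real, norm_norm] at h2
    rw [← ballOp_expSqOp, ← hv]
    have h3 := norm_ballOp_apply_le x₀ n (gaussianOp Ω hc₁ x₀ h)
    rcases (norm_nonneg (ballOp Ω x₀ n v)).eq_or_lt with h0 | h0
    · rw [← h0]; positivity
    · have h4 : ‖ballOp Ω x₀ n v‖ ≤ Real.exp (-(E * s)) * ‖ballOp Ω x₀ n (gaussianOp Ω hc₁ x₀ h)‖ := by
        refine le_of_mul_le_mul_left ?_ h0
        calc _ = ‖ballOp Ω x₀ n v‖ ^ 2 := by ring
          _ ≤ _ := h2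
          _ = _ := by ring
      exact h4.trans (by gcongr)
  have hlim := tendsto_ballOp_apply x₀ (((gaussianOp Ω hc₂ x₀).continuous.tendsto _).comp
    (((T s).continuous.tendsto _).comp (tendsto_ballOp x₀ h)))
  exact le_of_tendsto hlim.norm (Eventually.of_forall key)

end WeightedBounds

/-! ### From the spectrum of the generator to the norm of `T 1` -/

section Generator

variable {X : Type*} [NormedAddCommGroup X] [InnerProductSpace ℂ X] [CompleteSpace X]
  {H : X →ₗ.[ℂ] X} {T : ℝ → X →L[ℂ] X}

theorem IsC0Semigroup.nonneg_of_isSelfAdjoint_generator (hT : IsC0Semigroup T)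
    (hH : IsSelfAdjoint H) (hgen : IsGenerator T (-H)) {t : ℝ} (ht : 0 ≤ t) : 0 ≤ T t := by
  refine hT.nonneg_of_isSelfAdjoint (fun t ht => hT.isSelfAdjoint ?_ ?_ ht) ht
  · intro u v u' v' hu hv
    obtain ⟨u, rfl, rfl⟩ := hgen.hasRightDeriv_iff.1 hu
    obtain ⟨v, rfl, rfl⟩ := hgen.hasRightDeriv_iff.1 hv
    have h := LinearPMap.adjoint_isFormalAdjoint hH.dense_domain
    rw [LinearPMap.isSelfAdjoint_def.1 hH] at h
    rw [inner_neg_left, inner_neg_right, h u v]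
  · refine hH.dense_domain.mono fun u hu => ?_
    exact ⟨_, hgen.hasRightDeriv_iff.2 ⟨⟨u, hu⟩, rfl, rfl⟩⟩

/-- If `r = log ‖T 1‖ > -E`, then `-r < E` lies in the resolvent set of `H`, and the resolvent there
is the left inverse excluded by `norm_ne_of_leftInverse`. -/
theorem IsC0Semigroup.norm_one_le_exp (hT : IsC0Semigroup T)
    (hH : IsSelfAdjoint H) (hgen : IsGenerator T (-H)) {E : ℝ}
    (hE : ∀ r : ℝ, (r : ℂ) ∈ opSpectrum H → E ≤ r) : ‖T 1‖ ≤ Real.exp (-E) := by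
  by_contra! hlt
  have hpos : 0 < ‖T 1‖ := (Real.exp_pos _).trans hlt
  set r := Real.log ‖T 1‖ with hr
  have hr1 : -E < r := (Real.lt_log_iff_exp_lt hpos).2 hlt
  have hres : ((-r : ℝ) : ℂ) ∈ opResolventSet H := by
    by_contra hn
    linarith [hE (-r) hn]
  obtain ⟨R, -, hR⟩ := hres
  refine hT.norm_ne_of_leftInverse (fun t ht => hT.nonneg_of_isSelfAdjoint_generator hH hgen ht)
    (r := r) R ?_ (Real.exp_log hpos).symm
  intro u g hug
  obtain ⟨u, rfl, rfl⟩ := hgen.hasRightDeriv_iff.1 hug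
  rw [← hR u]
  congr 1
  rw [hR u, Complex.ofReal_neg, neg_smul]
  abel

end Generator

/-! ### From weighted `L₂` bounds to the sup norm -/

section PointwiseBounds

variable {d : ℕ}

lemma integrable_exp_neg_mul_norm_sub_sq {b : ℝ} (hb : 0 < b) (x₀ : EuclideanSpace ℝ (Fin d)) :
    Integrable fun y : EuclideanSpace ℝ (Fin d) => Real.exp (-(b * ‖y - x₀‖ ^ 2)) := by
  have h : Integrable fun y : EuclideanSpace ℝ (Fin d) => Real.exp (-b * ‖y‖ ^ 2) := by
    -- A non-integrable function has integral `0` by convention, contradicting the positive value of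
    -- the Gaussian integral.
    by_contra hn
    have h1 := GaussianFourier.integral_rexp_neg_mul_sq_norm (V := EuclideanSpace ℝ (Fin d)) hb
    rw [integral_undef hn] at h1
    have : 0 < (Real.pi / b) ^ ((Module.finrank ℝ (EuclideanSpace ℝ (Fin d)) : ℝ) / 2) := by
      positivity
    linarith
  simpa using h.comp_sub_right x₀

lemma setIntegral_exp_neg_mul_norm_sub_sq_le {b : ℝ} (hb : 0 < b)
    (x₀ : EuclideanSpace ℝ (Fin d)) (Ω : Set (EuclideanSpace ℝ (Fin d))) :
    ∫ y in Ω, Real.exp (-(b * ‖y - x₀‖ ^ 2)) ≤ (Real.pi / b) ^ ((d : ℝ) / 2) := by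
  refine (setIntegral_le_integral (integrable_exp_neg_mul_norm_sub_sq hb x₀)
    (Eventually.of_forall fun y => (Real.exp_pos _).le)).trans (le_of_eq ?_)
  rw [integral_sub_right_eq_self (fun y : EuclideanSpace ℝ (Fin d) => Real.exp (-(b * ‖y‖ ^ 2))) x₀]
  have h1 := GaussianFourier.integral_rexp_neg_mul_sq_norm (V := EuclideanSpace ℝ (Fin d)) hb
  simpa using h1

lemma sq_norm_eq_integral {α : Type*} [MeasurableSpace α] {μ : Measure α} (f : Lp ℂ 2 μ) :
    ‖f‖ ^ 2 = ∫ x, ‖f x‖ ^ 2 ∂μ := by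
  have h1 := inner_self_eq_norm_sq_to_K (𝕜 := ℂ) f
  have h2 : inner ℂ f f = ((∫ x, ‖f x‖ ^ 2 ∂μ : ℝ) : ℂ) := by
    rw [L2.inner_def, ← integral_complex_ofReal]
    refine integral_congr_ae (Eventually.of_forall fun x => ?_)
    simp only [Complex.ofReal_pow]
    exact inner_self_eq_norm_sq_to_K (𝕜 := ℂ) (f x)
  rw [h2] at h1
  exact Complex.ofReal_injective (by rw [Complex.ofReal_pow]; exact h1.symm)

lemma coeFn_gaussianOp {Ω : Set (EuclideanSpace ℝ (Fin d))} {c : ℝ} (hc : 0 ≤ c)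
    (x₀ : EuclideanSpace ℝ (Fin d)) (f : L2 Ω) :
    ∀ᵐ y ∂(volume.restrict Ω),
      ‖gaussianOp Ω hc x₀ f y‖ = Real.exp (-(c * ‖y - x₀‖ ^ 2)) * ‖f y‖ := by
  filter_upwards [coeFn_mulOp _ (memLp_gaussian Ω hc x₀) f] with y hy
  rw [gaussianOp, hy, norm_mul, Complex.norm_real, Real.norm_of_nonneg (Real.exp_pos _).le]

lemma norm_gaussianOp_le_of_bounded {Ω : Set (EuclideanSpace ℝ (Fin d))} {c : ℝ} (hc : 0 < c)
    (x₀ : EuclideanSpace ℝ (Fin d)) {f : L2 Ω} (hf : ∀ᵐ y ∂(volume.restrict Ω), ‖f y‖ ≤ 1) :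
    ‖gaussianOp Ω hc.le x₀ f‖ ≤ (Real.pi / (2 * c)) ^ ((d : ℝ) / 4) := by
  have h1 : ‖gaussianOp Ω hc.le x₀ f‖ ^ 2 ≤ (Real.pi / (2 * c)) ^ ((d : ℝ) / 2) := by
    rw [sq_norm_eq_integral]
    refine le_trans ?_ (setIntegral_exp_neg_mul_norm_sub_sq_le (b := 2 * c) (by positivity) x₀ Ω)
    refine integral_mono_of_nonneg (Eventually.of_forall fun y => by positivity)
      (integrable_exp_neg_mul_norm_sub_sq (by positivity) x₀).restrict ?_
    filter_upwards [coeFn_gaussianOp hc.le x₀ f, hf] with y h1 h2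
    rw [h1, mul_pow, ← Real.exp_nat_mul]
    calc _ ≤ Real.exp ((2 : ℕ) * -(c * ‖y - x₀‖ ^ 2)) * 1 ^ 2 := by gcongr
      _ = _ := by rw [one_pow, mul_one]; congr 1; push_cast; ring
  refine le_of_sq_le_sq ?_ (by positivity)
  refine h1.trans (le_of_eq ?_)
  rw [← Real.rpow_natCast, ← Real.rpow_mul (by positivity)]
  congr 1; push_cast; ring

variable {Ω : Set (EuclideanSpace ℝ (Fin d))} {T : ℝ → L2 Ω →L[ℂ] L2 Ω} {M ω a E : ℝ}

/-- The Gaussian exponent is split as `1/(a r) = β + c`: the `c` part stays with `h` as a weight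
centred at the evaluation point, and Cauchy–Schwarz integrates the `β` part. -/
theorem HasGaussianUpperBounds.norm_apply_le (hgauss : HasGaussianUpperBounds T M ω a)
    (hM : 0 ≤ M) (ha : 0 < a) {r c β : ℝ} (hr : 0 < r) (hc : 0 ≤ c) (hβ : 0 < β)
    (hcβ : β + c = 1 / (a * r)) (h : L2 Ω) :
    ∀ᵐ x ∂(volume.restrict Ω), ‖T r h x‖ ≤
      M * Real.exp (ω * r) * (a * Real.pi * r) ^ (-(d : ℝ) / 2)
        * (Real.pi / (2 * β)) ^ ((d : ℝ) / 4) * ‖gaussianOp Ω hc x h‖ := by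
  obtain ⟨p, hp, hbound⟩ := hgauss r hr
  set K := M * Real.exp (ω * r) * (a * Real.pi * r) ^ (-(d : ℝ) / 2) with hK
  have hK0 : 0 ≤ K := by positivity
  filter_upwards [hp.2 h, Measure.ae_ae_of_ae_prod hbound] with x hx hx2
  have hsq : ∀ y, Real.exp (-(β * ‖y - x‖ ^ 2)) ^ 2 = Real.exp (-(2 * β * ‖y - x‖ ^ 2)) := by
    intro y
    rw [← Real.exp_nat_mul]
    congr 1; push_cast; ring
  have hG : MemLp (fun y => Real.exp (-(β * ‖y - x‖ ^ 2))) 2 (volume.restrict Ω) := by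
    rw [memLp_two_iff_integrable_sq (by fun_prop)]
    simp only [hsq]
    exact (integrable_exp_neg_mul_norm_sub_sq (by positivity) x).restrict
  have hN : MemLp (fun y => ‖gaussianOp Ω hc x h y‖) 2 (volume.restrict Ω) :=
    (Lp.memLp _).norm
  have hCS := integral_mul_le_Lp_mul_Lq_of_nonneg Real.HolderConjugate.two_two
    (Eventually.of_forall fun y => (Real.exp_pos (-(β * ‖y - x‖ ^ 2))).le)
    (Eventually.of_forall fun y => norm_nonneg (gaussianOp Ω hc x h y))
    (by simpa using hG) (by simpa using hN)
  simp only [Real.rpow_two, hsq, ← sq_norm_eq_integral] at hCS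
  have e1 : (‖gaussianOp Ω hc x h‖ ^ 2) ^ (1 / 2 : ℝ) = ‖gaussianOp Ω hc x h‖ := by
    rw [← Real.sqrt_eq_rpow, Real.sqrt_sq (norm_nonneg _)]
  have e2 : (∫ y in Ω, Real.exp (-(2 * β * ‖y - x‖ ^ 2))) ^ (1 / 2 : ℝ)
      ≤ (Real.pi / (2 * β)) ^ ((d : ℝ) / 4) := by
    calc _ ≤ ((Real.pi / (2 * β)) ^ ((d : ℝ) / 2)) ^ (1 / 2 : ℝ) :=
          Real.rpow_le_rpow (integral_nonneg fun _ => (Real.exp_pos _).le)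
            (setIntegral_exp_neg_mul_norm_sub_sq_le (by positivity) x Ω) (by norm_num)
      _ = _ := by
        rw [← Real.rpow_mul (by positivity)]
        congr 1; ring
  rw [e1] at hCS
  rw [hx.2]
  calc ‖∫ y in Ω, p (x, y) * h y‖
      ≤ ∫ y in Ω, K * (Real.exp (-(β * ‖y - x‖ ^ 2)) * ‖gaussianOp Ω hc x h y‖) := by
        refine norm_integral_le_of_norm_le ((hG.integrable_mul hN).const_mul K) ?_
        filter_upwards [hx2, coeFn_gaussianOp hc x h] with y hy1 hy2
        rw [hy2, norm_mul, ← mul_assoc, ← mul_assoc, mul_assoc K, ← Real.exp_add]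
        gcongr
        refine hy1.trans (le_of_eq ?_)
        congr 2
        have : -(β * ‖y - x‖ ^ 2) + -(c * ‖y - x‖ ^ 2) = -((β + c) * ‖y - x‖ ^ 2) := by ring
        rw [this, hcβ, norm_sub_rev]
        ring
    _ = K * ∫ y in Ω, Real.exp (-(β * ‖y - x‖ ^ 2)) * ‖gaussianOp Ω hc x h y‖ :=
        integral_const_mul _ _
    _ ≤ K * ((Real.pi / (2 * β)) ^ ((d : ℝ) / 4) * ‖gaussianOp Ω hc x h‖) := by
        gcongr
        exact hCS.trans (by gcongr)
    _ = _ := by ring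

/-- The parameter `b = κ s` keeps the weights meaningful at `s = 0`, the case `ε = 1`. -/
lemma norm_gaussianOp_apply_le_of_nonneg (hT : IsC0Semigroup T) (hpos : ∀ t, 0 ≤ t → 0 ≤ T t)
    (h1 : ‖T 1‖ ≤ Real.exp (-E)) (hM : 0 ≤ M) (ha : 0 < a)
    (hgauss : HasGaussianUpperBounds T M ω a) {b s : ℝ} (hb : 0 < b) (hs : 0 ≤ s)
    (x₀ : EuclideanSpace ℝ (Fin d)) {c₁ c₂ : ℝ} (hc₁ : 0 ≤ c₁) (hc₂ : 0 ≤ c₂)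
    (e₁ : c₁ = 1 / (2 * b + a * s)) (e₂ : c₂ = 1 / (2 * b)) (h : L2 Ω) :
    ‖gaussianOp Ω hc₂ x₀ (T s h)‖ ≤ Real.exp (-(E * s)) * ‖gaussianOp Ω hc₁ x₀ h‖ := by
  rcases hs.eq_or_lt with rfl | hs
  · have : c₁ = c₂ := by rw [e₁, e₂, mul_zero, add_zero]
    subst this
    simp [hT.zero]
  · refine norm_gaussianOp_apply_le hT hpos h1 hM ha hgauss (div_pos hb hs) x₀ hs hc₁ hc₂ ?_ ?_ h
    · rw [e₁]; field_simp
    · rw [e₂]; field_simp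

theorem normInftyInfty_le (hT : IsC0Semigroup T) (hpos : ∀ t, 0 ≤ t → 0 ≤ T t)
    (h1 : ‖T 1‖ ≤ Real.exp (-E)) (hM : 0 ≤ M) (ha : 0 < a)
    (hgauss : HasGaussianUpperBounds T M ω a) {ε t : ℝ} (hε : ε ∈ Set.Ioc (0 : ℝ) 1) (ht : 0 < t) :
    normInftyInfty (T t) ≤ ENNReal.ofReal (M * ((1 + 1 / Real.sqrt ε) / 2) ^ ((d : ℝ) / 2)
      * Real.exp (ε * (E + ω) * t - E * t)) := by
  refine iSup₂_le fun f hf => ?_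
  have hf1 : ∀ᵐ y ∂(volume.restrict Ω), ‖f y‖ ≤ 1 := by
    rw [eLpNorm_exponent_top] at hf
    filter_upwards [ae_le_eLpNormEssSup (f := f) (μ := volume.restrict Ω)] with y hy
    have := hy.trans hf
    rw [← ofReal_norm] at this
    exact ENNReal.ofReal_le_one.1 this
  rw [eLpNorm_exponent_top]
  refine eLpNormEssSup_le_of_ae_bound ?_
  have hε0 := hε.1
  have hε1 := hε.2
  set x := 1 / Real.sqrt ε with hx
  have hx0 : 0 < x := by positivity
  have hx2 : ε * x ^ 2 = 1 := by
    rw [hx, div_pow, Real.sq_sqrt hε0.le]; field_simp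
  set r := ε * t with hr
  set s := (1 - ε) * t with hs
  have hr0 : 0 < r := by positivity
  have hs0 : 0 ≤ s := mul_nonneg (by linarith) ht.le
  have hts : t = r + s := by rw [hr, hs]; ring
  have hsr : s = r * (x ^ 2 - 1) := by
    have : r * x ^ 2 = t := by rw [hr, mul_right_comm, hx2, one_mul]
    rw [mul_sub, this, mul_one, hts]; ring
  -- With `2 b = (1 + u) a r`, the final constant is governed by `(1 + u)(u + x²)/u = u + x²/u + 1 +
  -- x²`, which is minimal at `u = x` with value `(1 + x)²`.
  set b := (1 + x) / 2 * (a * r) with hb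
  have hb0 : 0 < b := by positivity
  have hB : 2 * b + a * s = a * r * ((1 + x) * x) := by rw [hb, hsr]; ring
  have hc₁ : 0 < 1 / (2 * b + a * s) := by positivity
  have hc₂ : 0 ≤ 1 / (2 * b) := by positivity
  have hβ : 0 < x / ((1 + x) * (a * r)) := by positivity
  have hβc : x / ((1 + x) * (a * r)) + 1 / (2 * b) = 1 / (a * r) := by
    rw [hb]; field_simp; ring
  filter_upwards [hgauss.norm_apply_le hM ha hr0 hc₂ hβ hβc (T s f)] with y hy
  have h2 := norm_gaussianOp_apply_le_of_nonneg hT hpos h1 hM ha hgauss hb0 hs0 y hc₁.le hc₂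
    rfl rfl f
  have h3 := norm_gaussianOp_le_of_bounded hc₁ y hf1
  have e : T t f = T r (T s f) := by rw [hts, hT.add_apply hr0.le hs0]
  have hconst : (a * Real.pi * r) ^ (-(d : ℝ) / 2)
      * (Real.pi / (2 * (x / ((1 + x) * (a * r))))) ^ ((d : ℝ) / 4)
      * (Real.pi / (2 * (1 / (2 * b + a * s)))) ^ ((d : ℝ) / 4)
      = ((1 + x) / 2) ^ ((d : ℝ) / 2) := by
    have e1 : (Real.pi / (2 * (x / ((1 + x) * (a * r)))))
        * (Real.pi / (2 * (1 / (2 * b + a * s)))) = (a * Real.pi * r * ((1 + x) / 2)) ^ 2 := by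
      rw [hB]; field_simp
    rw [mul_assoc, ← Real.mul_rpow (by positivity) (by positivity), e1, ← Real.rpow_natCast,
      ← Real.rpow_mul (by positivity)]
    have e2 : ((2 : ℕ) : ℝ) * ((d : ℝ) / 4) = (d : ℝ) / 2 := by push_cast; ring
    have hp : 0 < a * Real.pi * r := by positivity
    have hx1 : 0 ≤ (1 + x) / 2 := by positivity
    rw [e2, Real.mul_rpow hp.le hx1, ← mul_assoc, ← Real.rpow_add hp]
    have e3 : -(d : ℝ) / 2 + (d : ℝ) / 2 = 0 := by ring
    rw [e3, Real.rpow_zero, one_mul]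
  rw [e]
  calc _ ≤ _ := hy
    _ ≤ M * Real.exp (ω * r) * (a * Real.pi * r) ^ (-(d : ℝ) / 2)
        * (Real.pi / (2 * (x / ((1 + x) * (a * r))))) ^ ((d : ℝ) / 4)
        * (Real.exp (-(E * s)) * (Real.pi / (2 * (1 / (2 * b + a * s)))) ^ ((d : ℝ) / 4)) := by
      gcongr
      exact h2.trans (by gcongr)
    _ = M * ((a * Real.pi * r) ^ (-(d : ℝ) / 2)
        * (Real.pi / (2 * (x / ((1 + x) * (a * r))))) ^ ((d : ℝ) / 4)
        * (Real.pi / (2 * (1 / (2 * b + a * s)))) ^ ((d : ℝ) / 4))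
        * (Real.exp (ω * r) * Real.exp (-(E * s))) := by ring
    _ = _ := by
      rw [hconst, ← Real.exp_add]
      congr 2
      rw [hr, hs]; ring

end PointwiseBounds

end

theorem theorem2p1 (d : ℕ) (hd : 0 < d)
    (Ω : Set (EuclideanSpace ℝ (Fin d))) (hΩ : NullMeasurableSet Ω volume)
    (H : L2 Ω →ₗ.[ℂ] L2 Ω) (hH : IsSelfAdjoint H)
    (E₀ : ℝ) (hE₀ : IsGLB {r : ℝ | (r : ℂ) ∈ opSpectrum H} E₀)
    (T : ℝ → L2 Ω →L[ℂ] L2 Ω) (hT : IsC0Semigroup T) (hgen : IsGenerator T (-H))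
    (M ω a : ℝ) (hM : 1 ≤ M) (ha : 0 < a) (hgauss : HasGaussianUpperBounds T M ω a)
    (ε : ℝ) (hε : ε ∈ Set.Ioc (0 : ℝ) 1) (t : ℝ) (ht : 0 ≤ t) :
    normInftyInfty (T t) ≤
      ENNReal.ofReal ((2 : ℝ) ^ (1 / 4 : ℝ) * M
        * ((1 + 1 / Real.sqrt ε) / 2) ^ ((d : ℝ) / 2)
        * Real.exp (ε * (E₀ + ω) * t - E₀ * t)) := by
  have hε0 := hε.1
  have h2 : (1 : ℝ) ≤ (2 : ℝ) ^ (1 / 4 : ℝ) := Real.one_le_rpow one_le_two (by norm_num)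
  rcases ht.eq_or_lt with rfl | ht
  -- At `t = 0` there is no kernel; the operator is the identity and every factor on the right is at
  -- least `1`.
  · have hx : 1 ≤ 1 / Real.sqrt ε := by
      rw [le_div_iff₀ (by positivity), one_mul]
      exact Real.sqrt_le_one.2 hε.2
    have hy : 1 ≤ ((1 + 1 / Real.sqrt ε) / 2) ^ ((d : ℝ) / 2) :=
      Real.one_le_rpow (by linarith) (by positivity)
    refine iSup₂_le fun f hf => ?_
    rw [hT.zero, ContinuousLinearMap.id_apply]
    refine hf.trans ?_
    rw [ENNReal.one_le_ofReal, mul_zero, mul_zero, sub_zero, Real.exp_zero, mul_one]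
    exact one_le_mul_of_one_le_of_one_le (one_le_mul_of_one_le_of_one_le h2 hM) hy
  · have hE : ∀ r : ℝ, (r : ℂ) ∈ opSpectrum H → E₀ ≤ r := fun r hr => hE₀.1 hr
    refine (normInftyInfty_le hT
      (fun t ht => hT.nonneg_of_isSelfAdjoint_generator hH hgen ht)
      (hT.norm_one_le_exp hH hgen hE) (by linarith) ha hgauss hε ht).trans ?_
    refine ENNReal.ofReal_le_ofReal ?_
    gcongr
    exact le_mul_of_one_le_left (by linarith) h2
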